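/- Let $T$ be a complete first-order theory in a language $L$ and let $\mathcal C$ be a monster model of $T$, that is, a $\kappa$-saturated and strongly $\kappa$-homogeneous model for some $\kappa>|L|+\aleph_0$; a set is \emph{small} if its cardinality is $<\kappa$. Work in $\mathcal C^{eq}$: tuples are finite tuples of imaginaries, sets are sets of imaginaries, and formulas are formulas of $L^{eq}$, up to equivalence in $\mathcal C^{eq}$. A formula $\delta(x,a)$ \emph{strongly divides} over $A$ if $tp(a/A)$ is non-algebraic and $\{\delta(x,a')\}_{a'\models tp(a/A)}$ is $k$-inconsistent for some $k\in\mathbb N$ (i.e. no $x$ satisfies $\delta(x,a')$ for $k$ distinct such $a'$). It \emph{þ-divides} over $A$ if it strongly divides over $Ac$ for some tuple $c$. A formula \emph{þ-forks} over $A$ if it implies a finite disjunction of formulas which þ-divide over $A$. The tuple $a$ is \emph{þ-independent} of $b$ over $A$ if no formula in $tp(a/Ab)$ þ-forks over $A$. For a formula $\phi(x)$ with parameters, a set $\Delta$ of formulas in the variables $x;y$, a set $\Pi$ of formulas in the variables $y;z$, both without parameters, and $k\in\mathbb N$, define $\text{þ}(\phi,\Delta,\Pi,k)\ge\alpha$ by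 recursion on the ordinal $\alpha$: it is $\ge 0$ iff $\phi$ is consistent; for limit $\lambda$ it is $\ge\lambda$ iff it is $\ge\alpha$ for all $\alpha<\lambda$; and it is $\ge\alpha+1$ iff there are $\delta\in\Delta$, $\pi\in\Pi$ and a tuple $c$ such that $\{\delta(x,a)\}_{a\models\pi(y,c)}$ is $k$-inconsistent and $\text{þ}(\phi\wedge\delta(x,a),\Delta,\Pi,k)\ge\alpha$ for infinitely many $a\models\pi(y,c)$. The theory $T$ is \emph{rosy} if all these ranks with $\Delta$, $\Pi$ finite are defined, i.e. for all $\phi$, all finite $\Delta,\Pi$ and all $k$, the rank is not $\ge\alpha$ for every ordinal $\alpha$. \textbf{Theorem.} $T$ is rosy if and only if þ-forking satisfies symmetry, i.e. for every small set $A$ and all tuples $a,b$ in $\mathcal C^{eq}$, if $a$ is þ-independent of $b$ over $A$, then $b$ is þ-independent of $a$ over $A$. -/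

import Mathlib

open FirstOrder

universe u v w

namespace ThornForking

section Monster

variable {L : FirstOrder.Language.{u, v}}

/-- `C` is `κ`-saturated: over every set of fewer than `κ` parameters, every finitely satisfiable
set of formulas in finitely many variables is realized. -/
def IsSaturated (L : FirstOrder.Language.{u, v}) (C : Type w) [L.Structure C] (κ : Cardinal.{w}) : Prop :=
  ∀ A : Set C, Cardinal.mk A < κ → ∀ (n : ℕ) (p : Set (L[[A]].Formula (Fin n))),
    (∀ S : Finset (L[[A]].Formula (Fin n)), ↑S ⊆ p → ∃ x : Fin n → C, ∀ φ ∈ S, φ.Realize x) →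
      ∃ x : Fin n → C, ∀ φ ∈ p, φ.Realize x

/-- `C` is strongly `κ`-homogeneous: every partial elementary map with domain of cardinality
less than `κ` extends to an automorphism. -/
def IsStronglyHomogeneous (L : FirstOrder.Language.{u, v}) (C : Type w) [L.Structure C]
    (κ : Cardinal.{w}) : Prop :=
  ∀ A : Set C, Cardinal.mk A < κ → ∀ f : A → C,
    (∀ φ : L.Formula A, φ.Realize (fun a : A => (a : C)) ↔ φ.Realize f) →
      ∃ σ : C ≃[L] C, ∀ a : A, σ a = f a

/-- `C` is a monster model of `T`, in which a set is small when its cardinality is less than `κ`. -/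
structure IsMonsterModel (T : L.Theory) (C : Type w) [L.Structure C] (κ : Cardinal.{w}) :
    Prop where
  models : C ⊨ T
  aleph0_lt : Cardinal.aleph0 < κ
  card_lt : Cardinal.lift.{w} L.card < Cardinal.lift.{max u v} κ
  saturated : IsSaturated L C κ
  homogeneous : IsStronglyHomogeneous L C κ

end Monster

section Imaginaries

variable (L : FirstOrder.Language.{u, v}) (C : Type w) [L.Structure C]

/-- A sort of `C^eq`: a finite arity `n` together with an equivalence relation on `C^n` that is
definable without parameters. -/
structure ImSort where
  arity : ℕ
  rel : Setoid (Fin arity → C)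
  definable : (∅ : Set C).Definable L
    {v : Fin arity ⊕ Fin arity → C | rel (v ∘ Sum.inl) (v ∘ Sum.inr)}

/-- The imaginary elements: the disjoint union of all sorts `C^n / E`. -/
abbrev Imag : Type w := Σ s : ImSort L C, Quotient s.rel

/-- The sorts of a finite tuple of variables of `C^eq`. -/
structure Ctx where
  length : ℕ
  sort : Fin length → ImSort L C

end Imaginaries

variable {L : FirstOrder.Language.{u, v}} {C : Type w} [L.Structure C]

namespace Ctx

/-- Finite tuples of imaginaries, of the sorts prescribed by `X`. -/
abbrev Tuple (X : Ctx L C) : Type w := ∀ i : Fin X.length, Quotient (X.sort i).rel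

/-- The home-sort variables that represent the variables of `X`. -/
abbrev Index (X : Ctx L C) : Type := Σ i : Fin X.length, Fin (X.sort i).arity

/-- The tuple of imaginaries represented by a tuple of home-sort elements. -/
def proj (X : Ctx L C) (v : X.Index → C) : X.Tuple :=
  fun i => Quotient.mk (X.sort i).rel fun j => v ⟨i, j⟩

end Ctx

/-- The set of imaginaries that occur in a tuple. -/
def entries {X : Ctx L C} (a : X.Tuple) : Set (Imag L C) :=
  Set.range fun i => (⟨X.sort i, a i⟩ : Imag L C)

/-- A formula `φ(x; y)` of `L^eq` without parameters, up to equivalence in `C^eq`: a relation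
between tuples of imaginaries whose pullback to the home sort is defined by an `L`-formula
without parameters. -/
structure EqFormula (X Y : Ctx L C) where
  holds : X.Tuple → Y.Tuple → Prop
  definable : (∅ : Set C).Definable L
    {v : X.Index ⊕ Y.Index → C | holds (X.proj (v ∘ Sum.inl)) (Y.proj (v ∘ Sum.inr))}

/-- The set of solutions of `φ(x, a)`. -/
def EqFormula.solutions {X Y : Ctx L C} (φ : EqFormula X Y) (a : Y.Tuple) : Set X.Tuple :=
  {x | φ.holds x a}

/-- `D` is the set of solutions of a formula of `L^eq` with parameters in `A`. -/
def DefinableOver {X : Ctx L C} (A : Set (Imag L C)) (D : Set X.Tuple) : Prop :=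
  ∃ (Y : Ctx L C) (φ : EqFormula X Y) (b : Y.Tuple), entries b ⊆ A ∧ D = φ.solutions b

/-- The realizations in `C^eq` of `tp(a/A)`. -/
def realizations {X : Ctx L C} (a : X.Tuple) (A : Set (Imag L C)) : Set X.Tuple :=
  {a' | ∀ D : Set X.Tuple, DefinableOver A D → (a ∈ D ↔ a' ∈ D)}

/-- `tp(a/A)` is algebraic: it contains a formula with only finitely many solutions. -/
def IsAlgebraic {X : Ctx L C} (a : X.Tuple) (A : Set (Imag L C)) : Prop :=
  ∃ D : Set X.Tuple, DefinableOver A D ∧ a ∈ D ∧ D.Finite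

/-- The family `{δ(x, a) : a ∈ P}` is `k`-inconsistent: no `k` of its members are jointly
satisfiable. -/
def IsInconsistentFamily {X Y : Ctx L C} (δ : EqFormula X Y) (P : Set Y.Tuple) (k : ℕ) : Prop :=
  ∀ S : Finset Y.Tuple, ↑S ⊆ P → S.card = k → ¬ ∃ x : X.Tuple, ∀ a ∈ S, δ.holds x a

/-- The formula `δ(x, a)` strongly divides over `A`. -/
def StronglyDivides {X Y : Ctx L C} (δ : EqFormula X Y) (a : Y.Tuple) (A : Set (Imag L C)) :
    Prop :=
  ¬ IsAlgebraic a A ∧ ∃ k : ℕ, IsInconsistentFamily δ (realizations a A) k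

/-- The formula `δ(x, a)` þ-divides over `A`. -/
def ThornDivides {X Y : Ctx L C} (δ : EqFormula X Y) (a : Y.Tuple) (A : Set (Imag L C)) : Prop :=
  ∃ (Z : Ctx L C) (c : Z.Tuple), StronglyDivides δ a (A ∪ entries c)

/-- The formula with set of solutions `D` þ-forks over `A`: it implies a finite disjunction of
formulas each of which þ-divides over `A`. -/
def ThornForks {X : Ctx L C} (D : Set X.Tuple) (A : Set (Imag L C)) : Prop :=
  ∃ (n : ℕ) (Y : Fin n → Ctx L C) (δ : ∀ i, EqFormula X (Y i)) (d : ∀ i, (Y i).Tuple),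
    (∀ i, ThornDivides (δ i) (d i) A) ∧ D ⊆ ⋃ i, (δ i).solutions (d i)

/-- `a` is þ-independent of `b` over `A`: no formula in `tp(a/Ab)` þ-forks over `A`. -/
def ThornIndep {X Y : Ctx L C} (A : Set (Imag L C)) (a : X.Tuple) (b : Y.Tuple) : Prop :=
  ∀ D : Set X.Tuple, DefinableOver (A ∪ entries b) D → a ∈ D → ¬ ThornForks D A

/-- þ-forking satisfies symmetry (over small sets of imaginaries). -/
def ThornSymmetric (L : FirstOrder.Language.{u, v}) (C : Type w) [L.Structure C] (κ : Cardinal.{w}) : Prop :=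
  ∀ A : Set (Imag L C), Cardinal.mk A < κ →
    ∀ (X Y : Ctx L C) (a : X.Tuple) (b : Y.Tuple), ThornIndep A a b → ThornIndep A b a

/-- `ThornRankGE Δ Ps k α D` says that `þ(φ, Δ, Ps, k) ≥ α`, where `D` is the set of solutions of
`φ`. It is defined by recursion on the ordinal `α`. -/
noncomputable def ThornRankGE {X Y Z : Ctx L C} (Δ : Set (EqFormula X Y))
    (Ps : Set (EqFormula Y Z)) (k : ℕ) (α : Ordinal.{w}) : Set X.Tuple → Prop :=
  Ordinal.limitRecOn (motive := fun _ => Set X.Tuple → Prop) α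
    (fun D => D.Nonempty)
    (fun _ rankGE D => ∃ δ ∈ Δ, ∃ π ∈ Ps, ∃ c : Z.Tuple,
      {a : Y.Tuple | a ∈ π.solutions c ∧ rankGE (D ∩ δ.solutions a)}.Infinite ∧
        IsInconsistentFamily δ (π.solutions c) k)
    (fun lam _ rankGE D => ∀ β, (hβ : β < lam) → rankGE β hβ D)

/-- All þ-ranks are defined: for every formula `φ` (with parameters), all finite sets of formulas
`Δ`, `Ps` and every `k`, the rank `þ(φ, Δ, Ps, k)` is not `∞`. -/
def IsRosy (L : FirstOrder.Language.{u, v}) (C : Type w) [L.Structure C] : Prop :=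
  ∀ (X Y Z : Ctx L C) (D : Set X.Tuple), DefinableOver Set.univ D →
    ∀ (Δ : Set (EqFormula X Y)) (Ps : Set (EqFormula Y Z)), Δ.Finite → Ps.Finite →
      ∀ k : ℕ, ∃ α : Ordinal.{w}, ¬ ThornRankGE Δ Ps k α D

end ThornForking

/-!
Both implications go through one compactness fact about þ-ranks. For finitely many formulas
`δ(x; y)`, `π(y; z)`, the condition that the rank of `φ(x, d)` is at least `n` is type-definable in
`d` (`typeDef_rankGE`). By saturation, a formula whose rank is at least every natural number can
therefore be divided, by a parameter outside of the algebraic closure of any given small set, so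
that the resulting formula has the same property (`exists_step_of_forall_rankGE`). Hence the rank of
a formula is either finite or undefined (`thornRankGE_of_forall_rankGE`).

If some rank is undefined, iterating the division step gives a sequence `I` of pairs `(a_n, c_n)`
and a common solution `b` of one formula `δ(x, a_n)`, where `δ(x, a_n)` is `k`-inconsistent along
`π(y, c_n)` and `a_n` is not algebraic over `c_n` and the earlier terms. Let `(a, c)` realize an
average type of the sequence over `I` and `b`. Its type over `I` and `b` is finitely satisfiable
in `I`, so it does not þ-fork over `I` (`not_thornForks_of_mem`), whereas `δ(x, a)` þ-divides over
`I`; this violates symmetry (`not_thornSymmetric_of_sequence`).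

Conversely, let `a` be þ-independent of `b` over `A` while some formula `R(x, a)` of `tp(b/Aa)`
þ-forks over `A`. By extension there are realizations `e_0, e_1, …` of `tp(a/Ab)`, each
þ-independent over `A` of its predecessors. A þ-independent tuple does not make anything algebraic
(`IndepFrom.not_alg`), so the þ-forking of `R(x, e_i)` can be witnessed by parameters that are not
algebraic over the later terms `e_{i+1}, …, e_{N-1}` (`ForksAlong.exists_union`). So when the
parameters `e_{N-1}, …, e_0` are adjoined one at a time, the rank of `b` with respect to the
patterns involved drops at each step, and it is at least `N` in the beginning, for every `N`
(`rankGE_of_forksAlong`). These patterns may use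
variables of different sorts; a pigeonhole argument on ranks (`rankGE.exists_single`) leaves a
single pattern of unbounded rank, and its þ-rank is undefined.

All arguments take place in the imaginary sorts; `ImTuple`, `Coord` and `DefOver` provide the
calculus of definable sets there.
-/

namespace ThornForking

/-! ### Tuples of imaginaries and definability without parameters -/

section Calculus

/-- A type of finite tuples of imaginaries: `τ` is identified with a finite product of sorts.
Unlike `Ctx.Tuple`, the notion is closed under products without reindexing by `Fin n`. -/
class ImTuple (L : outParam (FirstOrder.Language.{u, v})) (C : outParam (Type w)) [L.Structure C]
    (τ : Type w) where
  ι : Type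
  fintype : Fintype ι
  sort : ι → ImSort L C
  coord : τ ≃ ∀ i, Quotient (sort i).rel

variable {L : FirstOrder.Language.{u, v}} {C : Type w} [L.Structure C]
variable {τ σ ρ : Type w} [ImTuple L C τ] [ImTuple L C σ] [ImTuple L C ρ]

attribute [reducible, instance] ImTuple.fintype

instance (s : ImSort L C) : ImTuple L C (Quotient s.rel) where
  ι := Unit
  fintype := inferInstance
  sort _ := s
  coord := (Equiv.funUnique Unit (Quotient s.rel)).symm

instance : ImTuple L C (τ × σ) where
  ι := ImTuple.ι τ ⊕ ImTuple.ι σ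
  fintype := inferInstance
  sort := Sum.elim ImTuple.sort ImTuple.sort
  coord := (Equiv.prodCongr ImTuple.coord ImTuple.coord).trans
    (Equiv.sumPiEquivProdPi fun i =>
      Quotient (Sum.elim (ImTuple.sort (τ := τ)) (ImTuple.sort (τ := σ)) i).rel).symm

instance {J : Type} [Fintype J] {τ : J → Type w} [∀ j, ImTuple L C (τ j)] :
    ImTuple L C (∀ j, τ j) where
  ι := Σ j, ImTuple.ι (τ j)
  fintype := inferInstance
  sort p := ImTuple.sort p.2
  coord := (Equiv.piCongrRight fun _ => ImTuple.coord).trans (Equiv.piCurry _).symm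

/-- The home-sort variables that represent a variable ranging over `τ`. -/
abbrev Idx (τ : Type w) [ImTuple L C τ] : Type :=
  Σ i : ImTuple.ι τ, Fin (ImTuple.sort (L := L) (C := C) i).arity

/-- The tuple of imaginaries represented by a tuple of home-sort elements. -/
def proj (τ : Type w) [ImTuple L C τ] (v : Idx τ → C) : τ :=
  ImTuple.coord.symm fun i => Quotient.mk (ImTuple.sort i).rel fun j => v ⟨i, j⟩

/-- A home-sort representative of a tuple of imaginaries, chosen sort by sort. -/
noncomputable def rep (t : τ) : Idx τ → C := fun p => (ImTuple.coord t p.1).out p.2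

@[simp] theorem proj_rep (t : τ) : proj τ (rep t) = t := by
  have h : (fun i => Quotient.mk (ImTuple.sort i).rel fun j => rep t ⟨i, j⟩) = ImTuple.coord t :=
    funext fun i => Quotient.out_eq (s := (ImTuple.sort i).rel) (ImTuple.coord t i)
  rw [proj, h, Equiv.symm_apply_apply]

theorem proj_surjective : Function.Surjective (proj τ) := fun t => ⟨rep t, proj_rep t⟩

/-- The set of imaginaries that occur in a tuple. -/
def ents (t : τ) : Set (Imag L C) := Set.range fun i => ⟨ImTuple.sort i, ImTuple.coord t i⟩

/-- A map between tuple types given by a substitution of variables: on home-sort representatives it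
selects, permutes or repeats coordinates. -/
@[fun_prop]
def Coord (f : τ → σ) : Prop := ∃ g : Idx σ → Idx τ, ∀ v, f (proj τ v) = proj σ (v ∘ g)

@[fun_prop] theorem Coord.id : Coord (fun t : τ => t) := ⟨_root_.id, fun _ => rfl⟩

@[fun_prop] theorem Coord.comp {f : σ → ρ} {g : τ → σ} (hf : Coord f) (hg : Coord g) :
    Coord fun t => f (g t) := by
  obtain ⟨f', hf⟩ := hf
  obtain ⟨g', hg⟩ := hg
  exact ⟨g' ∘ f', fun v => by beta_reduce; rw [hg, hf]; rfl⟩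

/-- The variables of `τ` among those of `τ × σ`. -/
def idxInl : Idx τ → Idx (τ × σ) := fun p => ⟨Sum.inl p.1, p.2⟩

/-- The variables of `σ` among those of `τ × σ`. -/
def idxInr : Idx σ → Idx (τ × σ) := fun p => ⟨Sum.inr p.1, p.2⟩

/-- A variable of `τ × σ` is a variable of `τ` or of `σ`. -/
def idxSplit : Idx (τ × σ) → Idx τ ⊕ Idx σ
  | ⟨Sum.inl i, p⟩ => Sum.inl ⟨i, p⟩
  | ⟨Sum.inr i, p⟩ => Sum.inr ⟨i, p⟩

@[fun_prop] theorem Coord.fst {f : ρ → τ × σ} (hf : Coord f) : Coord fun t => (f t).1 :=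
  Coord.comp (f := Prod.fst) ⟨idxInl, fun _ => rfl⟩ hf

@[fun_prop] theorem Coord.snd {f : ρ → τ × σ} (hf : Coord f) : Coord fun t => (f t).2 :=
  Coord.comp (f := Prod.snd) ⟨idxInr, fun _ => rfl⟩ hf

@[fun_prop] theorem Coord.prodMk {f : ρ → τ} {g : ρ → σ} (hf : Coord f) (hg : Coord g) :
    Coord fun t => (f t, g t) := by
  obtain ⟨f', hf⟩ := hf
  obtain ⟨g', hg⟩ := hg
  refine ⟨Sum.elim f' g' ∘ idxSplit, fun v => ?_⟩
  beta_reduce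
  rw [hf, hg]
  rfl

@[fun_prop] theorem Coord.apply {J : Type} [Fintype J] {τ : J → Type w} [∀ j, ImTuple L C (τ j)]
    (j : J) : Coord (fun t : ∀ j, τ j => t j) := ⟨fun p => ⟨⟨j, p.1⟩, p.2⟩, fun _ => rfl⟩

theorem coord_coord (i : ImTuple.ι τ) : Coord fun t : τ => ImTuple.coord t i :=
  ⟨fun p => ⟨i, p.2⟩, fun v => by simp [proj]; rfl⟩

/-- A relation on tuples of imaginaries that is defined by a formula of `L^eq` without
parameters. -/
def Def0 (P : τ → Prop) : Prop := (∅ : Set C).Definable L {v : Idx τ → C | P (proj τ v)}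

namespace Def0

theorem and {P Q : τ → Prop} (hP : Def0 P) (hQ : Def0 Q) : Def0 fun t => P t ∧ Q t :=
  hP.inter hQ

theorem not {P : τ → Prop} (hP : Def0 P) : Def0 fun t => ¬ P t := hP.compl

theorem or {P Q : τ → Prop} (hP : Def0 P) (hQ : Def0 Q) : Def0 fun t => P t ∨ Q t :=
  hP.union hQ

theorem imp {P Q : τ → Prop} (hP : Def0 P) (hQ : Def0 Q) : Def0 fun t => P t → Q t := by
  simpa only [imp_iff_not_or] using hP.not.or hQ

theorem const (p : Prop) : Def0 fun _ : τ => p := by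
  by_cases h : p
  · simp only [Def0, h]; exact Set.definable_univ
  · simp only [Def0, h]; exact Set.definable_empty

theorem forall_fin {J : Type*} [Finite J] {P : J → τ → Prop} (hP : ∀ j, Def0 (P j)) :
    Def0 fun t => ∀ j, P j t := by
  have := Set.definable_iInter_of_finite hP
  rwa [← Set.ofPred_forall] at this

theorem exists_fin {J : Type*} [Finite J] {P : J → τ → Prop} (hP : ∀ j, Def0 (P j)) :
    Def0 fun t => ∃ j, P j t := by
  simpa using (forall_fin fun j => (hP j).not).not

theorem comp {P : σ → Prop} (hP : Def0 P) {f : τ → σ} (hf : Coord f) : Def0 fun t => P (f t) := by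
  obtain ⟨g, hg⟩ := hf
  have := hP.preimage_comp g
  unfold Def0
  simp only [hg]
  exact this

theorem ex {P : τ → σ → Prop} (hP : Def0 fun p : τ × σ => P p.1 p.2) :
    Def0 fun t => ∃ s, P t s := by
  have := (hP.preimage_comp (idxSplit : Idx (τ × σ) → _)).exists_of_finite
  unfold Def0
  convert! this using 3 with v
  exact (proj_surjective (τ := σ)).exists

theorem eq_quotient (s : ImSort L C) :
    Def0 fun p : Quotient s.rel × Quotient s.rel => p.1 = p.2 := by
  have := s.definable.preimage_comp
    (Sum.elim (fun j => idxInl ⟨(), j⟩) fun j => idxInr ⟨(), j⟩ :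
      _ → Idx (Quotient s.rel × Quotient s.rel))
  unfold Def0
  convert! this using 1
  ext v
  exact Quotient.eq (r := s.rel)

theorem eq_coord (i : ImTuple.ι τ) :
    Def0 fun p : τ × τ => ImTuple.coord p.1 i = ImTuple.coord p.2 i :=
  (eq_quotient (ImTuple.sort i)).comp (((coord_coord i).comp (Coord.fst Coord.id)).prodMk
    ((coord_coord i).comp (Coord.snd Coord.id)))

theorem eq {f g : ρ → τ} (hf : Coord f) (hg : Coord g) : Def0 fun t => f t = g t := by
  have h : Def0 fun p : τ × τ => p.1 = p.2 := by
    have := forall_fin fun i => eq_coord (τ := τ) i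
    simpa only [← funext_iff, EmbeddingLike.apply_eq_iff_eq] using this
  exact h.comp (hf.prodMk hg)

theorem injective {m : ℕ} {f : ρ → Fin m → τ} (hf : ∀ i, Coord fun t => f t i) :
    Def0 fun t => (f t).Injective :=
  forall_fin fun i => forall_fin fun j => (eq (hf i) (hf j)).imp (const (i = j))

/-- The parameters for which the fibre has at least `m` elements form a definable set. -/
theorem many {P : τ → σ → Prop} (hP : Def0 fun p : τ × σ => P p.1 p.2) (m : ℕ) :
    Def0 fun s => ∃ f : Fin m → τ, f.Injective ∧ ∀ i, P (f i) s := by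
  refine ex (P := fun s (f : Fin m → τ) => f.Injective ∧ ∀ i, P (f i) s) ?_
  refine (injective fun i => by fun_prop).and (forall_fin fun i => ?_)
  exact hP.comp (f := fun q : σ × (Fin m → τ) => (q.2 i, q.1)) (by fun_prop)

end Def0

end Calculus

/-! ### Definability over a set of imaginaries -/

section Parameters

variable {L : FirstOrder.Language.{u, v}} {C : Type w} [L.Structure C]
variable {τ σ ρ : Type w} [ImTuple L C τ] [ImTuple L C σ] [ImTuple L C ρ]

/-- The context of a variable ranging over `τ`. -/
noncomputable def ctxOf (τ : Type w) [ImTuple L C τ] : Ctx L C where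
  length := Fintype.card (ImTuple.ι τ)
  sort k := ImTuple.sort ((Fintype.equivFin (ImTuple.ι τ)).symm k)

/-- A tuple type is identified with the tuples of a context. -/
noncomputable def toCtx : τ ≃ (ctxOf τ).Tuple :=
  ImTuple.coord.trans (Equiv.piCongrLeft (fun i => Quotient (ImTuple.sort (τ := τ) i).rel)
    (Fintype.equivFin (ImTuple.ι τ)).symm).symm

theorem toCtx_apply (t : τ) (k : Fin (ctxOf τ).length) :
    toCtx t k = ImTuple.coord t ((Fintype.equivFin (ImTuple.ι τ)).symm k) := by
  rfl

theorem Coord.symm_of_bijective {e : τ ≃ σ} {g : Idx σ → Idx τ} (hg : g.Bijective)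
    (h : ∀ v, e (proj τ v) = proj σ (v ∘ g)) : Coord fun s => e.symm s := by
  obtain ⟨k, hk, -⟩ := Function.bijective_iff_has_inverse.1 hg
  refine ⟨k, fun v => ?_⟩
  rw [Equiv.symm_apply_eq, h, Function.comp_assoc, (funext hk : k ∘ g = _root_.id),
    Function.comp_id]

/-- The home-sort variables of `ctxOf τ` are those of `τ`. -/
noncomputable def idxCtx : Idx (ctxOf τ).Tuple → Idx τ :=
  fun p => ⟨(Fintype.equivFin (ImTuple.ι τ)).symm p.1.1, p.2⟩

theorem idxCtx_bijective : (idxCtx (τ := τ)).Bijective := by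
  constructor
  · rintro ⟨⟨k, ⟨⟩⟩, p⟩ ⟨⟨k', ⟨⟩⟩, p'⟩ h
    have hk : k = k' := (Fintype.equivFin (ImTuple.ι τ)).symm.injective (congrArg Sigma.fst h)
    subst hk
    have := eq_of_heq (Sigma.mk.inj h).2
    exact congrArg _ this
  · rintro ⟨i, p⟩
    obtain ⟨k, rfl⟩ := (Fintype.equivFin (ImTuple.ι τ)).symm.surjective i
    exact ⟨⟨⟨k, ()⟩, p⟩, rfl⟩

theorem toCtx_proj (v : Idx τ → C) : toCtx (proj τ v) = proj (ctxOf τ).Tuple (v ∘ idxCtx) := by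
  funext k
  rw [toCtx_apply, proj, Equiv.apply_symm_apply]
  rfl

@[fun_prop] theorem Coord.toCtx_symm {f : σ → (ctxOf τ).Tuple} (hf : Coord f) :
    Coord fun t => ThornForking.toCtx.symm (f t) :=
  Coord.comp (f := fun t => ThornForking.toCtx.symm t)
    (Coord.symm_of_bijective idxCtx_bijective toCtx_proj) hf

theorem entries_eq_ents {X : Ctx L C} (a : X.Tuple) : entries a = ents a := by
  ext x
  exact ⟨fun ⟨i, hi⟩ => ⟨⟨i, ()⟩, hi⟩, fun ⟨i, hi⟩ => ⟨i.1, hi⟩⟩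

theorem entries_toCtx (t : τ) : entries (toCtx t) = ents t := by
  unfold entries ents
  rw [← (Fintype.equivFin (ImTuple.ι τ)).symm.surjective.range_comp]
  rfl

theorem ents_prod (t : τ) (s : σ) : ents (t, s) = ents t ∪ ents s :=
  Sum.range_eq _

theorem ents_pi {J : Type} [Fintype J] {τ : J → Type w} [∀ j, ImTuple L C (τ j)] (t : ∀ j, τ j) :
    ents t = ⋃ j, ents (t j) := by
  ext x
  simp only [ents, Set.mem_range, Set.mem_iUnion]
  exact ⟨fun ⟨i, hi⟩ => ⟨i.1, i.2, hi⟩, fun ⟨j, i, hi⟩ => ⟨⟨j, i⟩, hi⟩⟩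

theorem finite_ents (t : τ) : (ents t).Finite := Set.finite_range _

theorem def0_iff_definable {X Y : Ctx L C} {P : X.Tuple → Y.Tuple → Prop} :
    (Def0 fun p : X.Tuple × Y.Tuple => P p.1 p.2) ↔ (∅ : Set C).Definable L
      {v : X.Index ⊕ Y.Index → C | P (X.proj (v ∘ Sum.inl)) (Y.proj (v ∘ Sum.inr))} := by
  let f (X : Ctx L C) : X.Index → Idx X.Tuple := fun p => ⟨⟨p.1, ()⟩, p.2⟩
  let g (X : Ctx L C) : Idx X.Tuple → X.Index := fun p => ⟨p.1.1, p.2⟩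
  refine ⟨fun h => ?_, fun h => ?_⟩
  · exact h.preimage_comp (Sum.map (g X) (g Y) ∘ idxSplit)
  · exact h.preimage_comp (Sum.elim (idxInl ∘ f X) (idxInr ∘ f Y))

theorem EqFormula.def0 {X Y : Ctx L C} (φ : EqFormula X Y) :
    Def0 fun p : X.Tuple × Y.Tuple => φ.holds p.1 p.2 :=
  def0_iff_definable.2 φ.definable

theorem EqFormula.def0_holds {X Y : Ctx L C} (φ : EqFormula X Y) {f : τ → X.Tuple}
    {g : τ → Y.Tuple} (hf : Coord f) (hg : Coord g) : Def0 fun t => φ.holds (f t) (g t) :=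
  φ.def0.comp (hf.prodMk hg)

/-- The formula `φ(x; y)` given by a definable relation, with `y` ranging over any tuple type. -/
noncomputable def mkFormula {X : Ctx L C} (P : X.Tuple → τ → Prop)
    (hP : Def0 fun p : X.Tuple × τ => P p.1 p.2) : EqFormula X (ctxOf τ) where
  holds x y := P x (toCtx.symm y)
  definable := def0_iff_definable (P := fun x (y : (ctxOf τ).Tuple) => P x (toCtx.symm y)).1 <|
    hP.comp (f := fun p : X.Tuple × (ctxOf τ).Tuple => (p.1, toCtx.symm p.2)) (by fun_prop)

/-- `DefinableOver` for sets of tuples of any type: `D` is the set of solutions of a formula of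
`L^eq` with parameters in `A`. -/
def DefOver (A : Set (Imag L C)) (D : Set τ) : Prop :=
  ∃ (Y : Ctx L C) (b : Y.Tuple) (P : τ → Y.Tuple → Prop), ents b ⊆ A ∧
    (Def0 fun p : τ × Y.Tuple => P p.1 p.2) ∧ D = {t | P t b}

theorem definableOver_iff {X : Ctx L C} {A : Set (Imag L C)} {D : Set X.Tuple} :
    DefinableOver A D ↔ DefOver A D := by
  constructor
  · rintro ⟨Y, φ, b, hb, rfl⟩
    exact ⟨Y, b, φ.holds, entries_eq_ents b ▸ hb, φ.def0, rfl⟩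
  · rintro ⟨Y, b, P, hb, hP, rfl⟩
    exact ⟨Y, ⟨P, def0_iff_definable.1 hP⟩, b, (entries_eq_ents b).symm ▸ hb, rfl⟩

namespace DefOver

variable {A B : Set (Imag L C)}

theorem intro {P : τ → σ → Prop} (hP : Def0 fun p : τ × σ => P p.1 p.2) (s : σ)
    (hs : ents s ⊆ A) : DefOver A {t | P t s} :=
  ⟨ctxOf σ, toCtx s, fun t y => P t (toCtx.symm y), by rwa [← entries_eq_ents, entries_toCtx],
    hP.comp (f := fun p : τ × (ctxOf σ).Tuple => (p.1, toCtx.symm p.2)) (by fun_prop), by simp⟩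

theorem mono {D : Set τ} (h : DefOver A D) (hAB : A ⊆ B) : DefOver B D := by
  obtain ⟨Y, b, P, hb, hP, rfl⟩ := h
  exact ⟨Y, b, P, hb.trans hAB, hP, rfl⟩

theorem of_def0 {P : τ → Prop} (h : Def0 P) : DefOver A {t | P t} := by
  let e : (∀ i : Fin 0, Quotient ((⟨0, Fin.elim0⟩ : Ctx L C).sort i).rel) := fun i => i.elim0
  exact intro (P := fun t _ => P t) (h.comp (f := Prod.fst) (by fun_prop)) e
    (by rintro _ ⟨⟨i, _⟩, -⟩; exact i.elim0)

theorem compl {D : Set τ} (h : DefOver A D) : DefOver A Dᶜ := by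
  obtain ⟨Y, b, P, hb, hP, rfl⟩ := h
  exact ⟨Y, b, fun t y => ¬ P t y, hb, hP.not, rfl⟩

theorem inter {D E : Set τ} (hD : DefOver A D) (hE : DefOver A E) : DefOver A (D ∩ E) := by
  obtain ⟨Y, b, P, hb, hP, rfl⟩ := hD
  obtain ⟨Z, c, Q, hc, hQ, rfl⟩ := hE
  refine intro (P := fun t (y : Y.Tuple × Z.Tuple) => P t y.1 ∧ Q t y.2) ?_ (b, c) ?_
  · exact (hP.comp (f := fun p : τ × (Y.Tuple × Z.Tuple) => (p.1, p.2.1)) (by fun_prop)).and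
      (hQ.comp (f := fun p : τ × (Y.Tuple × Z.Tuple) => (p.1, p.2.2)) (by fun_prop))
  · rw [ents_prod]
    exact Set.union_subset hb hc

theorem union {D E : Set τ} (hD : DefOver A D) (hE : DefOver A E) : DefOver A (D ∪ E) := by
  simpa [Set.compl_inter] using (hD.compl.inter hE.compl).compl

theorem univ : DefOver A (Set.univ : Set τ) := of_def0 (Def0.const True)

theorem biInter {J : Type*} {s : Set J} (hs : s.Finite) {D : J → Set τ}
    (h : ∀ j ∈ s, DefOver A (D j)) : DefOver A (⋂ j ∈ s, D j) := by
  induction s, hs using Set.Finite.induction_on with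
  | empty => simpa using univ
  | insert _ _ ih =>
    rw [Set.biInter_insert]
    exact (h _ (by simp)).inter (ih fun j hj => h j (by simp [hj]))

theorem iInter {J : Type*} [Finite J] {D : J → Set τ} (h : ∀ j, DefOver A (D j)) :
    DefOver A (⋂ j, D j) := by
  simpa using biInter (s := Set.univ) Set.finite_univ fun j _ => h j

theorem sInter {F : Set (Set τ)} (hF : F.Finite) (h : ∀ D ∈ F, DefOver A D) :
    DefOver A (⋂₀ F) := by
  rw [Set.sInter_eq_biInter]
  exact biInter hF h

theorem preimage {D : Set σ} (h : DefOver A D) {f : τ → σ} (hf : Coord f) :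
    DefOver A {t | f t ∈ D} := by
  obtain ⟨Y, b, P, hb, hP, rfl⟩ := h
  exact ⟨Y, b, fun t y => P (f t) y, hb,
    hP.comp (f := fun p : τ × Y.Tuple => (f p.1, p.2)) (by fun_prop), rfl⟩

theorem ex {R : Set (τ × σ)} (h : DefOver A R) : DefOver A {t | ∃ s, (t, s) ∈ R} := by
  obtain ⟨Y, b, P, hb, hP, rfl⟩ := h
  refine ⟨Y, b, fun t y => ∃ s, P (t, s) y, hb, ?_, rfl⟩
  exact Def0.ex (P := fun (p : τ × Y.Tuple) s => P (p.1, s) p.2)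
    (hP.comp (f := fun p : (τ × Y.Tuple) × σ => ((p.1.1, p.2), p.1.2)) (by fun_prop))

theorem all {R : Set (τ × σ)} (h : DefOver A R) : DefOver A {t | ∀ s, (t, s) ∈ R} := by
  have := (ex h.compl).compl
  simpa [Set.compl_ofPred] using this

/-- Substituting a tuple for variables adds its entries to the parameters. -/
theorem fiber {R : Set (τ × σ)} (h : DefOver A R) (s : σ) :
    DefOver (A ∪ ents s) {t | (t, s) ∈ R} := by
  obtain ⟨Y, b, P, hb, hP, rfl⟩ := h
  refine intro (P := fun t (y : σ × Y.Tuple) => P (t, y.1) y.2) ?_ (s, b) ?_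
  · exact hP.comp (f := fun p : τ × (σ × Y.Tuple) => ((p.1, p.2.1), p.2.2)) (by fun_prop)
  · rw [ents_prod, Set.union_comm]
    exact Set.union_subset_union_left _ hb

theorem eq_const (s : σ) (hs : ents s ⊆ A) {f : τ → σ} (hf : Coord f) :
    DefOver A {t | f t = s} :=
  intro (P := fun t s => f t = s)
    (Def0.eq (f := fun p : τ × σ => f p.1) (g := Prod.snd) (by fun_prop) (by fun_prop)) s hs

theorem singleton (s : τ) : DefOver (ents s) {s} := eq_const s le_rfl Coord.id

theorem def0_imag_eq (s s' : ImSort L C) :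
    Def0 fun p : Quotient s.rel × Quotient s'.rel => (⟨s, p.1⟩ : Imag L C) = ⟨s', p.2⟩ := by
  by_cases h : s = s'
  · subst h
    simpa using Def0.eq_quotient s
  · simpa [h] using Def0.const False

theorem def0_imag_eq_coord (i : ImTuple.ι τ) (j : ImTuple.ι σ) :
    Def0 fun p : τ × σ =>
      (⟨_, ImTuple.coord p.1 i⟩ : Imag L C) = ⟨_, ImTuple.coord p.2 j⟩ :=
  (def0_imag_eq _ _).comp (f := fun p : τ × σ => (ImTuple.coord p.1 i, ImTuple.coord p.2 j))
    (((coord_coord i).comp (Coord.fst Coord.id)).prodMk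
      ((coord_coord j).comp (Coord.snd Coord.id)))

/-- Conversely to `DefOver.fiber`, parameters among the entries of a tuple can be replaced by
variables. -/
theorem exists_fiber {D : Set τ} {s : σ} (h : DefOver (A ∪ ents s) D) :
    ∃ R : Set (τ × σ), DefOver A R ∧ D = {t | (t, s) ∈ R} := by
  obtain ⟨Y, b, P, hb, hP, rfl⟩ := h
  have key : ∀ i, ∃ E : Set (Y.Tuple × σ), DefOver A E ∧ (b, s) ∈ E ∧
      ∀ y, (y, s) ∈ E → ImTuple.coord y i = ImTuple.coord b i := by
    intro i
    rcases hb ⟨i, rfl⟩ with hA | ⟨j, hj⟩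
    · refine ⟨{p | ImTuple.coord p.1 i = ImTuple.coord b i},
        eq_const (f := fun p : Y.Tuple × σ => ImTuple.coord p.1 i) _ ?_
          ((coord_coord i).comp (Coord.fst Coord.id)), rfl, fun y hy => hy⟩
      rintro _ ⟨⟨⟩, rfl⟩
      exact hA
    · refine ⟨_, of_def0 (def0_imag_eq_coord i j), hj.symm, fun y hy => ?_⟩
      have := Eq.trans hy hj
      exact eq_of_heq (Sigma.mk.inj this).2
  choose E hE hbE hEi using key
  refine ⟨{p | ∃ y : Y.Tuple, P p.1 y ∧ ∀ i, (y, p.2) ∈ E i}, ?_, ?_⟩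
  · have h1 : DefOver A {q : (τ × σ) × Y.Tuple | P q.1.1 q.2} :=
      of_def0 (hP.comp (f := fun q : (τ × σ) × Y.Tuple => (q.1.1, q.2)) (by fun_prop))
    have h2 : DefOver A (⋂ i, {q : (τ × σ) × Y.Tuple | (q.2, q.1.2) ∈ E i}) :=
      iInter fun i => (hE i).preimage (f := fun q : (τ × σ) × Y.Tuple => (q.2, q.1.2)) (by fun_prop)
    have := (h1.inter h2).ex
    simpa using this
  · ext t
    refine ⟨fun ht => ⟨b, ht, hbE⟩, ?_⟩
    rintro ⟨y, hy, hyE⟩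
    have : y = b := ImTuple.coord.injective (funext fun i => hEi i y (hyE i))
    exact this ▸ hy

theorem many {R : Set (τ × σ)} (h : DefOver A R) (m : ℕ) :
    DefOver A {s | ∃ f : Fin m → τ, f.Injective ∧ ∀ i, (f i, s) ∈ R} := by
  obtain ⟨Y, b, P, hb, hP, rfl⟩ := h
  exact intro (P := fun s y => ∃ f : Fin m → τ, f.Injective ∧ ∀ i, P (f i, s) y)
    (Def0.many (P := fun t (q : σ × Y.Tuple) => P (t, q.1) q.2)
      (hP.comp (f := fun q : τ × (σ × Y.Tuple) => ((q.1, q.2.1), q.2.2)) (by fun_prop)) m) b hb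

end DefOver

end Parameters

/-! ### Saturation, algebraicity and types -/

section Saturation

variable {L : FirstOrder.Language.{u, v}} {C : Type w} [L.Structure C]
variable {τ σ ρ : Type w} [ImTuple L C τ] [ImTuple L C σ] [ImTuple L C ρ]
variable {T : L.Theory} {κ : Cardinal.{w}} {A B E : Set (Imag L C)}

open Cardinal

/-- Chosen home-sort representatives of the imaginaries in `A`. -/
def reps (A : Set (Imag L C)) : Set C := ⋃ x : A, Set.range (x : Imag L C).2.out

theorem rep_mem_reps {t : τ} (ht : ents t ⊆ A) (p : Idx τ) : rep t p ∈ reps A :=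
  Set.mem_iUnion.2 ⟨⟨_, ht ⟨p.1, rfl⟩⟩, p.2, rfl⟩

theorem mk_reps_lt (hκ : ℵ₀ < κ) (hA : #A < κ) : #(reps A) < κ := by
  have h : #(reps A) ≤ #A * ℵ₀ := by
    refine (mk_iUnion_le _).trans (mul_le_mul_right (ciSup_le' fun x => ?_) _)
    exact (Set.countable_range _).le_aleph0
  exact h.trans_lt (mul_lt_of_lt hκ.le hA hκ)

theorem small_union (hκ : ℵ₀ < κ) (hA : #A < κ) (hB : #B < κ) : #(A ∪ B : Set _) < κ :=
  (mk_union_le A B).trans_lt (add_lt_of_lt hκ.le hA hB)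

theorem small_of_countable (hκ : ℵ₀ < κ) (hA : A.Countable) : #A < κ := hA.le_aleph0.trans_lt hκ

theorem small_ents (hκ : ℵ₀ < κ) (t : τ) : #(ents t) < κ :=
  small_of_countable hκ (finite_ents t).countable

theorem small_union_ents (hκ : ℵ₀ < κ) (hA : #A < κ) (t : τ) : #(A ∪ ents t : Set _) < κ :=
  small_union hκ hA (small_ents hκ t)

theorem DefOver.definable_reps {D : Set τ} (h : DefOver A D) :
    (reps A).Definable L {v : Idx τ → C | proj τ v ∈ D} := by
  obtain ⟨Y, b, P, hb, hP, rfl⟩ := h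
  obtain ⟨φ, hφ⟩ := Set.empty_definable_iff.1 hP
  rw [Set.definable_iff_exists_formula_sum]
  refine ⟨φ.relabel (Sum.elim Sum.inr (fun q => Sum.inl ⟨rep b q, rep_mem_reps hb q⟩) ∘ idxSplit),
    ?_⟩
  ext v
  refine Iff.trans ?_ Language.Formula.realize_relabel.symm
  have := Set.ext_iff.1 hφ (Sum.elim v (rep b) ∘ idxSplit)
  have h2 : proj (τ × Y.Tuple) (Sum.elim v (rep b) ∘ idxSplit) = (proj τ v, b) :=
    Prod.ext rfl (proj_rep b)
  rw [Set.mem_ofPred_eq, h2, Set.mem_ofPred_eq] at this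
  refine this.trans (iff_of_eq (congrArg _ ?_))
  funext p
  rcases p with ⟨i | i, p⟩ <;> rfl

/-- Saturation of `C^eq`: a finitely satisfiable family of sets definable over a small set of
imaginaries has a common element. -/
theorem exists_mem_sInter (hC : IsMonsterModel T C κ) (hA : #A < κ) {F : Set (Set τ)}
    (hF : ∀ D ∈ F, DefOver A D) (hfin : ∀ S ⊆ F, S.Finite → (⋂₀ S).Nonempty) :
    (⋂₀ F).Nonempty := by
  obtain ⟨n, ⟨e⟩⟩ := Finite.exists_equiv_fin (Idx τ)
  let p : Set (L[[reps A]].Formula (Fin n)) :=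
    {ψ | ∃ D ∈ F, ∀ x : Fin n → C, ψ.Realize x ↔ proj τ (x ∘ e) ∈ D}
  obtain ⟨x, hx⟩ := hC.saturated (reps A) (mk_reps_lt hC.aleph0_lt hA) n p (by
    intro S hS
    choose! D hDF hD using hS
    obtain ⟨t, ht⟩ := hfin (D '' S) (by rintro _ ⟨ψ, hψ, rfl⟩; exact hDF hψ)
      (S.finite_toSet.image _)
    refine ⟨rep t ∘ e.symm, fun ψ hψ => ?_⟩
    rw [hD hψ, Function.comp_assoc, e.symm_comp_self, Function.comp_id, proj_rep]
    exact ht _ ⟨ψ, hψ, rfl⟩)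
  refine ⟨proj τ (x ∘ e), fun D hD => ?_⟩
  obtain ⟨ψ, hψ⟩ := (hF D hD).definable_reps.preimage_comp e
  have hr : ∀ y : Fin n → C, ψ.Realize y ↔ proj τ (y ∘ e) ∈ D := fun y => (Set.ext_iff.1 hψ y).symm
  exact (hr x).1 (hx ψ ⟨D, hD, hr⟩)

/-- `tp(t/A)` is algebraic, for a tuple of any type: `t` lies in a finite `A`-definable set. -/
def Alg (A : Set (Imag L C)) (t : τ) : Prop := ∃ D : Set τ, DefOver A D ∧ t ∈ D ∧ D.Finite

theorem isAlgebraic_iff {X : Ctx L C} {a : X.Tuple} : IsAlgebraic a A ↔ Alg A a := by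
  simp only [IsAlgebraic, Alg, definableOver_iff]

theorem Alg.mono {t : τ} (h : Alg A t) (hAB : A ⊆ B) : Alg B t := by
  obtain ⟨D, hD, h⟩ := h
  exact ⟨D, hD.mono hAB, h⟩

theorem DefOver.image {D : Set τ} (h : DefOver A D) {f : τ → σ} (hf : Coord f) :
    DefOver A (f '' D) := by
  have h1 : DefOver A {p : σ × τ | p.2 ∈ D} := h.preimage (f := fun p : σ × τ => p.2) (by fun_prop)
  have h2 : DefOver A {p : σ × τ | f p.2 = p.1} :=
    .of_def0 (Def0.eq (f := fun p : σ × τ => f p.2) (g := fun p => p.1) (by fun_prop) (by fun_prop))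
  exact (h1.inter h2).ex

theorem Alg.map {t : τ} (h : Alg A t) {f : τ → σ} (hf : Coord f) : Alg A (f t) := by
  obtain ⟨D, hD, ht, hfin⟩ := h
  exact ⟨f '' D, hD.image hf, ⟨t, ht, rfl⟩, hfin.image f⟩

theorem alg_ents (t : τ) : Alg (ents t) t := ⟨{t}, .singleton t, rfl, Set.finite_singleton t⟩

/-- A set that cannot be covered by the algebraic closure of a small set is infinite. -/
theorem infinite_of_forall_exists_not_alg (hC : IsMonsterModel T C κ) (hE : #E < κ) {D : Set τ}
    (h : ∀ B : Set (Imag L C), #B < κ → E ⊆ B → ∃ t ∈ D, ¬ Alg B t) : D.Infinite := by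
  intro hD
  obtain ⟨t, htD, ht⟩ := h (E ∪ ⋃ t ∈ D, ents t) (small_union hC.aleph0_lt hE
    (small_of_countable hC.aleph0_lt (hD.biUnion fun t _ => finite_ents t).countable))
    Set.subset_union_left
  exact ht ((alg_ents t).mono ((Set.subset_biUnion_of_mem (u := fun t => ents t) htD).trans
    Set.subset_union_right))

/-- A family of sets definable over a small set `E`, with infinite finite intersections, has a
common element outside of the algebraic closure of `E`: the complements of the finite `E`-definable
sets may be added to the family. -/
theorem exists_not_alg_mem_sInter (hC : IsMonsterModel T C κ) (hE : #E < κ) {F : Set (Set τ)}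
    (hF : ∀ D ∈ F, DefOver E D) (h : ∀ S ⊆ F, S.Finite → (⋂₀ S).Infinite) :
    ∃ t ∈ ⋂₀ F, ¬ Alg E t := by
  obtain ⟨t, ht⟩ := exists_mem_sInter hC hE (F := F ∪ {D | DefOver E D ∧ Dᶜ.Finite})
    (by rintro D (hD | hD); exacts [hF D hD, hD.1]) (by
      intro S hS hfin
      have h1 := h (S ∩ F) Set.inter_subset_right (hfin.subset Set.inter_subset_left)
      have h2 : (⋃ D ∈ {D ∈ S | Dᶜ.Finite}, Dᶜ).Finite :=
        (hfin.subset (Set.sep_subset _ _)).biUnion fun D hD => hD.2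
      obtain ⟨t, ht1, ht2⟩ := (h1.sdiff h2).nonempty
      refine ⟨t, fun D hD => ?_⟩
      rcases hS hD with hDF | hDE
      · exact ht1 D ⟨hD, hDF⟩
      · by_contra htD
        exact ht2 (Set.mem_biUnion (x := D) ⟨hD, hDE.2⟩ htD))
  refine ⟨t, fun D hD => ht D (Or.inl hD), ?_⟩
  rintro ⟨D, hD, htD, hfin⟩
  exact ht Dᶜ (Or.inr ⟨hD.compl, by rwa [compl_compl]⟩) htD

theorem infinite_sInter (hC : IsMonsterModel T C κ) (hE : #E < κ) {F : Set (Set τ)}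
    (hF : ∀ D ∈ F, DefOver E D) (h : ∀ S ⊆ F, S.Finite → (⋂₀ S).Infinite) :
    (⋂₀ F).Infinite :=
  infinite_of_forall_exists_not_alg hC hE fun _ hB hEB =>
    exists_not_alg_mem_sInter hC hB (fun D hD => (hF D hD).mono hEB) h

theorem exists_finset_biInter_eq {α J : Type*} {D : J → Set α} {S : Set (Set α)}
    (hS : S ⊆ Set.range D) (hfin : S.Finite) : ∃ s : Finset J, ⋂₀ S = ⋂ j ∈ s, D j := by
  classical
  obtain ⟨s, hs⟩ := hfin.exists_finset_coe
  rw [← hs, ← Set.image_univ] at hS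
  obtain ⟨s', -, rfl⟩ := Finset.subset_set_image_iff.1 hS
  refine ⟨s', ?_⟩
  rw [← hs, Finset.coe_image, Set.sInter_image]
  rfl

theorem exists_mem_iInter (hC : IsMonsterModel T C κ) (hA : #A < κ) {J : Type*} {D : J → Set τ}
    (hD : ∀ j, DefOver A (D j)) (h : ∀ s : Finset J, (⋂ j ∈ s, D j).Nonempty) :
    (⋂ j, D j).Nonempty := by
  refine exists_mem_sInter hC hA (by rintro _ ⟨j, rfl⟩; exact hD j) fun S hS hfin => ?_
  obtain ⟨s, hs⟩ := exists_finset_biInter_eq hS hfin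
  exact hs ▸ h s

theorem exists_not_alg_mem_iInter (hC : IsMonsterModel T C κ) (hE : #E < κ) {J : Type*}
    {D : J → Set τ} (hD : ∀ j, DefOver E (D j)) (h : ∀ s : Finset J, (⋂ j ∈ s, D j).Infinite) :
    ∃ t ∈ ⋂ j, D j, ¬ Alg E t := by
  refine exists_not_alg_mem_sInter hC hE (by rintro _ ⟨j, rfl⟩; exact hD j) fun S hS hfin => ?_
  obtain ⟨s, hs⟩ := exists_finset_biInter_eq hS hfin
  exact hs ▸ h s

theorem infinite_iInter (hC : IsMonsterModel T C κ) (hE : #E < κ) {J : Type*}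
    {D : J → Set τ} (hD : ∀ j, DefOver E (D j)) (h : ∀ s : Finset J, (⋂ j ∈ s, D j).Infinite) :
    (⋂ j, D j).Infinite :=
  infinite_of_forall_exists_not_alg hC hE fun _ hB hEB =>
    exists_not_alg_mem_iInter hC hB (fun j => (hD j).mono hEB) h

/-- `t` and `t'` have the same type over `A`. -/
def SameType (A : Set (Imag L C)) (t t' : τ) : Prop :=
  ∀ D : Set τ, DefOver A D → (t ∈ D ↔ t' ∈ D)

theorem mem_realizations_iff {X : Ctx L C} {a a' : X.Tuple} :
    a' ∈ realizations a A ↔ SameType A a a' := by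
  simp only [realizations, SameType, definableOver_iff, Set.mem_ofPred_eq]

namespace SameType

theorem symm {t t' : τ} (h : SameType A t t') : SameType A t' t := fun D hD => (h D hD).symm

theorem of_imp {t t' : τ} (h : ∀ D, DefOver A D → t ∈ D → t' ∈ D) : SameType A t t' :=
  fun D hD => ⟨h D hD, fun h' => by_contra fun hn => h _ hD.compl hn h'⟩

theorem mono {t t' : τ} (h : SameType B t t') (hAB : A ⊆ B) : SameType A t t' :=
  fun D hD => h D (hD.mono hAB)

theorem map {t t' : τ} (h : SameType A t t') {f : τ → σ} (hf : Coord f) :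
    SameType A (f t) (f t') := fun _ hD => h _ (hD.preimage hf)

/-- A realization of `tp(t/A)` extends to a realization of `tp(ts/A)`. -/
theorem exists_pair (hC : IsMonsterModel T C κ) (hA : #A < κ) {t t' : τ} (h : SameType A t t')
    (s : σ) : ∃ s' : σ, SameType A (t, s) (t', s') := by
  obtain ⟨s', hs'⟩ := exists_mem_sInter hC (small_union_ents hC.aleph0_lt hA t')
    (F := {D : Set σ | ∃ R : Set (τ × σ), DefOver A R ∧ (t, s) ∈ R ∧ D = {s | (t', s) ∈ R}})
    (by
      rintro _ ⟨R, hR, -, rfl⟩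
      exact (hR.preimage (f := fun p : σ × τ => (p.2, p.1)) (by fun_prop)).fiber t') (by
      intro S hS hfin
      have hS' : ∀ D ∈ S, ∃ R : Set (τ × σ), DefOver A R ∧ (t, s) ∈ R ∧ D = {s | (t', s) ∈ R} :=
        fun D hD => hS hD
      choose! R hR hts hRS using hS'
      have hdef : DefOver A (⋂ D ∈ S, R D) := DefOver.biInter hfin hR
      obtain ⟨s', hs'⟩ := (h _ hdef.ex).1 ⟨s, Set.mem_iInter₂.2 fun D hD => hts D hD⟩
      refine ⟨s', fun D hD => ?_⟩
      rw [hRS D hD]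
      exact Set.mem_iInter₂.1 hs' D hD)
  exact ⟨s', of_imp fun R hR hts => hs' _ ⟨R, hR, hts, rfl⟩⟩

end SameType

theorem infinite_sameType (hC : IsMonsterModel T C κ) (hA : #A < κ) {t : τ} (h : ¬ Alg A t) :
    {t' | SameType A t t'}.Infinite := by
  refine (infinite_sInter hC hA (F := {D | DefOver A D ∧ t ∈ D}) (fun D hD => hD.1) ?_).mono ?_
  · intro S hS hfin hS'
    exact h ⟨_, DefOver.sInter hfin fun D hD => (hS hD).1, fun D hD => (hS hD).2, hS'⟩
  · exact fun t' ht' => SameType.of_imp fun D hD htD => ht' D ⟨hD, htD⟩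

theorem finite_iff_exists_not_many {α : Type*} {D : Set α} :
    D.Finite ↔ ∃ m : ℕ, ¬ ∃ f : Fin m → α, f.Injective ∧ ∀ i, f i ∈ D := by
  constructor
  · intro h
    refine ⟨h.toFinset.card + 1, fun ⟨f, hf, hfD⟩ => ?_⟩
    have := Finset.card_le_card_of_injOn (s := Finset.univ) (t := h.toFinset) f
      (fun i _ => by simpa using hfD i) hf.injOn
    simp at this
  · rintro ⟨m, hm⟩
    by_contra hD
    let g := Set.Infinite.natEmbedding D hD
    exact hm ⟨fun i => g i, fun i j hij => Fin.ext (g.injective (Subtype.ext hij)),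
      fun i => (g i).2⟩

/-- Algebraicity of `t` over `As` depends only on `tp(ts/A)`. -/
theorem Alg.of_sameType {t t' : τ} {s s' : σ} (h : SameType A (t, s) (t', s'))
    (ht : Alg (A ∪ ents s) t) : Alg (A ∪ ents s') t' := by
  obtain ⟨D, hD, htD, hfin⟩ := ht
  obtain ⟨R, hR, rfl⟩ := hD.exists_fiber
  obtain ⟨m, hm⟩ := finite_iff_exists_not_many.1 hfin
  have hdef := hR.inter ((hR.many m).compl.preimage (f := fun p : τ × σ => p.2) (by fun_prop))
  obtain ⟨h1, h2⟩ := (h _ hdef).1 ⟨htD, hm⟩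
  exact ⟨_, hR.fiber s', h1, finite_iff_exists_not_many.2 ⟨m, h2⟩⟩

end Saturation

/-! ### Type-definable relations -/

section TypeDefinable

variable {L : FirstOrder.Language.{u, v}} {C : Type w} [L.Structure C]
variable {τ σ ρ : Type w} [ImTuple L C τ] [ImTuple L C σ] [ImTuple L C ρ]
variable {T : L.Theory} {κ : Cardinal.{w}} {A B E : Set (Imag L C)}

open Cardinal

/-- A relation that is a conjunction of (arbitrarily many) formulas without parameters. -/
def TypeDef (P : τ → Prop) : Prop :=
  ∃ F : Set (Set τ), (∀ D ∈ F, DefOver ∅ D) ∧ ∀ t, P t ↔ ∀ D : F, t ∈ D.1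

theorem DefOver.typeDef {D : Set τ} (h : DefOver ∅ D) : TypeDef fun t => t ∈ D :=
  ⟨{D}, by rintro _ rfl; exact h, fun t => by simp⟩

theorem Def0.typeDef {P : τ → Prop} (h : Def0 P) : TypeDef P := (DefOver.of_def0 h).typeDef

theorem DefOver.fiber_empty {R : Set (τ × σ)} (h : DefOver ∅ R) (s : σ) :
    DefOver (ents s) {t | (t, s) ∈ R} := by simpa using h.fiber s

namespace TypeDef

theorem and {P Q : τ → Prop} (hP : TypeDef P) (hQ : TypeDef Q) : TypeDef fun t => P t ∧ Q t := by
  obtain ⟨F, hF, hPF⟩ := hP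
  obtain ⟨G, hG, hQG⟩ := hQ
  refine ⟨F ∪ G, by rintro D (hD | hD); exacts [hF D hD, hG D hD], fun t => ?_⟩
  beta_reduce
  rw [hPF, hQG]
  simp only [Subtype.forall]
  exact ⟨fun h D hD => hD.elim (h.1 D) (h.2 D),
    fun h => ⟨fun D hD => h D (Or.inl hD), fun D hD => h D (Or.inr hD)⟩⟩

theorem exists_fin {J : Type*} [Finite J] {P : J → τ → Prop} (hP : ∀ j, TypeDef (P j)) :
    TypeDef fun t => ∃ j, P j t := by
  choose F hF hPF using hP
  refine ⟨Set.range fun g : ∀ j, F j => ⋃ j, (g j).1, ?_, fun t => ?_⟩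
  · rintro _ ⟨g, rfl⟩
    have := (DefOver.iInter fun j => (hF j _ (g j).2).compl).compl
    simpa [Set.compl_iInter] using this
  · constructor
    · rintro ⟨j, hj⟩ ⟨_, g, rfl⟩
      exact Set.mem_iUnion.2 ⟨j, (hPF j t).1 hj (g j)⟩
    · intro h
      by_contra hn
      have hn' : ∀ j, ∃ D : F j, t ∉ D.1 := fun j => by
        by_contra hj
        push Not at hj
        exact hn ⟨j, (hPF j t).2 hj⟩
      choose g hg using hn'
      obtain ⟨j, hj⟩ := Set.mem_iUnion.1 (h ⟨_, g, rfl⟩)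
      exact hg j hj

/-- By saturation, projections of type-definable sets are type-definable. -/
theorem ex (hC : IsMonsterModel T C κ) {P : τ → σ → Prop}
    (hP : TypeDef fun p : σ × τ => P p.2 p.1) : TypeDef fun t => ∃ s, P t s := by
  obtain ⟨F, hF, hPF⟩ := hP
  refine ⟨Set.range fun S : Finset F => {t | ∃ s, (s, t) ∈ ⋂ D ∈ S, D.1}, ?_, fun t => ?_⟩
  · rintro _ ⟨S, rfl⟩
    have h1 : DefOver ∅ (⋂ D ∈ S, D.1) :=
      DefOver.biInter S.finite_toSet fun D _ => hF D.1 D.2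
    exact (h1.preimage (f := fun p : τ × σ => (p.2, p.1)) (by fun_prop)).ex
  · constructor
    · rintro ⟨s, hs⟩ ⟨_, S, rfl⟩
      exact ⟨s, Set.mem_iInter₂.2 fun D _ => (hPF (s, t)).1 hs D⟩
    · intro h
      obtain ⟨s, hs⟩ := exists_mem_iInter hC (small_ents hC.aleph0_lt t)
        (D := fun D : F => {s | (s, t) ∈ D.1}) (fun D => (hF D.1 D.2).fiber_empty t) (fun S => by
          obtain ⟨s, hs⟩ := h ⟨_, S, rfl⟩
          exact ⟨s, Set.mem_iInter₂.2 fun D hD => Set.mem_iInter₂.1 hs D hD⟩)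
      exact ⟨s, (hPF (s, t)).2 fun D => Set.mem_iInter.1 hs D⟩

/-- By saturation, having an infinite fibre is a type-definable condition. -/
theorem infinite (hC : IsMonsterModel T C κ) {P : τ → σ → Prop}
    (hP : TypeDef fun p : τ × σ => P p.1 p.2) : TypeDef fun s => {t | P t s}.Infinite := by
  obtain ⟨F, hF, hPF⟩ := hP
  refine ⟨Set.range fun q : Finset F × ℕ =>
    {s | ∃ f : Fin q.2 → τ, f.Injective ∧ ∀ i, (f i, s) ∈ ⋂ D ∈ q.1, D.1}, ?_, fun s => ?_⟩
  · rintro _ ⟨q, rfl⟩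
    exact DefOver.many (DefOver.biInter q.1.finite_toSet fun D _ => hF D.1 D.2) q.2
  · constructor
    · rintro h ⟨_, q, rfl⟩
      by_contra hn
      refine h (finite_iff_exists_not_many.2 ⟨q.2, fun ⟨f, hf, hfP⟩ => hn ⟨f, hf, fun i => ?_⟩⟩)
      exact Set.mem_iInter₂.2 fun D _ => (hPF (f i, s)).1 (hfP i) D
    · intro h
      refine (infinite_iInter hC (small_ents hC.aleph0_lt s) (D := fun D : F => {t | (t, s) ∈ D.1})
        (fun D => (hF D.1 D.2).fiber_empty s) fun S => ?_).mono
        fun t ht => (hPF (t, s)).2 fun D => Set.mem_iInter.1 ht D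
      intro hfin
      obtain ⟨m, hm⟩ := finite_iff_exists_not_many.1 hfin
      obtain ⟨f, hf, hfS⟩ := h ⟨_, (S, m), rfl⟩
      exact hm ⟨f, hf, fun i => Set.mem_iInter₂.2 fun D hD => Set.mem_iInter₂.1 (hfS i) D hD⟩

theorem iff_of_sameType {P : τ → σ → Prop} (hP : TypeDef fun p : τ × σ => P p.1 p.2) {t t' : τ}
    {s : σ} (h : SameType (ents s) t t') : P t s ↔ P t' s := by
  obtain ⟨F, hF, hPF⟩ := hP
  refine (hPF (t, s)).trans (Iff.trans ?_ (hPF (t', s)).symm)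
  exact forall_congr' fun D => h _ ((hF D.1 D.2).fiber_empty s)

end TypeDef

/-- A decreasing sequence of nonempty type-definable sets has a common element. -/
theorem exists_forall_of_typeDef (hC : IsMonsterModel T C κ) {P : ℕ → τ → σ → Prop}
    (hP : ∀ n, TypeDef fun p : τ × σ => P n p.1 p.2) {s : σ}
    (hanti : ∀ m n t, m ≤ n → P n t s → P m t s) (h : ∀ n, ∃ t, P n t s) : ∃ t, ∀ n, P n t s := by
  choose F hF hPF using hP
  obtain ⟨t, ht⟩ := exists_mem_iInter hC (small_ents hC.aleph0_lt s)
    (D := fun q : Σ n, F n => {t | (t, s) ∈ q.2.1}) (fun q => (hF _ _ q.2.2).fiber_empty s)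
    (fun S => by
      obtain ⟨t, ht⟩ := h (S.sup Sigma.fst)
      exact ⟨t, Set.mem_iInter₂.2 fun q hq =>
        (hPF q.1 (t, s)).1 (hanti _ _ _ (Finset.le_sup (f := Sigma.fst) hq) ht) q.2⟩)
  exact ⟨t, fun n => (hPF n (t, s)).2 fun D => Set.mem_iInter.1 ht ⟨n, D⟩⟩

/-- A decreasing sequence of infinite type-definable sets has a common element that is not
algebraic over a given small set. -/
theorem exists_not_alg_forall_of_typeDef (hC : IsMonsterModel T C κ) {P : ℕ → τ → σ → Prop}
    (hP : ∀ n, TypeDef fun p : τ × σ => P n p.1 p.2) {s : σ}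
    (hanti : ∀ m n t, m ≤ n → P n t s → P m t s) (h : ∀ n, {t | P n t s}.Infinite)
    (hE : #E < κ) (hs : ents s ⊆ E) : ∃ t, ¬ Alg E t ∧ ∀ n, P n t s := by
  choose F hF hPF using hP
  obtain ⟨t, ht, hta⟩ := exists_not_alg_mem_iInter hC hE
    (D := fun q : Σ n, F n => {t | (t, s) ∈ q.2.1})
    (fun q => ((hF _ _ q.2.2).fiber_empty s).mono hs)
    (fun S => (h (S.sup Sigma.fst)).mono fun t ht => Set.mem_iInter₂.2 fun q hq =>
        (hPF q.1 (t, s)).1 (hanti _ _ _ (Finset.le_sup (f := Sigma.fst) hq) ht) q.2)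
  exact ⟨t, hta, fun n => (hPF n (t, s)).2 fun D => Set.mem_iInter.1 ht ⟨n, D⟩⟩

end TypeDefinable

/-! ### Finite þ-ranks -/

section Rank

variable {L : FirstOrder.Language.{u, v}} {C : Type w} [L.Structure C]
variable {τ σ : Type w} [ImTuple L C τ] [ImTuple L C σ]
variable {T : L.Theory} {κ : Cardinal.{w}} {A B E : Set (Imag L C)} {X : Ctx L C}

open Cardinal

theorem isInconsistentFamily_iff {Y : Ctx L C} {δ : EqFormula X Y} {S : Set Y.Tuple} {k : ℕ} :
    IsInconsistentFamily δ S k ↔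
      ¬ ∃ x, ∃ f : Fin k → Y.Tuple, f.Injective ∧ ∀ i, f i ∈ S ∧ δ.holds x (f i) := by
  constructor
  · rintro h ⟨x, f, hf, hfS⟩
    refine h (Finset.univ.map ⟨f, hf⟩) ?_ (by simp) ⟨x, ?_⟩
    · intro y hy
      obtain ⟨i, rfl⟩ : ∃ i, f i = y := by simpa using hy
      exact (hfS i).1
    · intro y hy
      obtain ⟨i, rfl⟩ : ∃ i, f i = y := by simpa using hy
      exact (hfS i).2
  · rintro h S' hS' hcard ⟨x, hx⟩
    have e := S'.equivFinOfCardEq hcard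
    exact h ⟨x, fun i => (e.symm i).1, Subtype.val_injective.comp e.symm.injective,
      fun i => ⟨hS' (e.symm i).2, hx _ (e.symm i).2⟩⟩

/-- An infinite family of formulas with a common solution is not `k`-inconsistent. -/
theorem not_isInconsistentFamily {Y : Ctx L C} {δ : EqFormula X Y} {S : Set Y.Tuple} {k : ℕ}
    {x : X.Tuple} (hS : S.Infinite) (hx : ∀ a ∈ S, δ.holds x a) : ¬ IsInconsistentFamily δ S k := by
  obtain ⟨S', hS', hcard⟩ := hS.exists_subset_card_eq k
  exact fun h => h S' hS' hcard ⟨x, fun a ha => hx a (hS' ha)⟩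

theorem IsInconsistentFamily.mono {Y : Ctx L C} {δ : EqFormula X Y} {S S' : Set Y.Tuple} {k : ℕ}
    (h : IsInconsistentFamily δ S k) (hS : S' ⊆ S) : IsInconsistentFamily δ S' k :=
  fun F hF => h F (hF.trans hS)

variable (X) in
/-- The data of one step of the þ-rank: formulas `δ(x; y)` and `π(y; z)` and a number `k`. -/
structure Pattern where
  Y : Ctx L C
  Z : Ctx L C
  δ : EqFormula X Y
  π : EqFormula Y Z
  k : ℕ

/-- The family `{δ(x, a) : a ⊨ π(y, c)}` is `k`-inconsistent. -/
def Pattern.Inconsistent (p : Pattern X) (c : p.Z.Tuple) : Prop :=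
  IsInconsistentFamily p.δ (p.π.solutions c) p.k

theorem Pattern.def0_inconsistent (p : Pattern X) : Def0 p.Inconsistent := by
  unfold Pattern.Inconsistent
  simp only [isInconsistentFamily_iff]
  refine (Def0.ex (P := fun c x => ∃ f : Fin p.k → p.Y.Tuple, f.Injective ∧
    ∀ i, f i ∈ p.π.solutions c ∧ p.δ.holds x (f i)) ?_).not
  refine Def0.ex (P := fun (q : p.Z.Tuple × X.Tuple) (f : Fin p.k → p.Y.Tuple) => f.Injective ∧
    ∀ i, f i ∈ p.π.solutions q.1 ∧ p.δ.holds q.2 (f i)) ?_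
  refine (Def0.injective fun i => by fun_prop).and (Def0.forall_fin fun i => Def0.and ?_ ?_)
  · exact p.π.def0_holds (f := fun q : (p.Z.Tuple × X.Tuple) × (Fin p.k → p.Y.Tuple) => q.2 i)
      (g := fun q => q.1.1) (by fun_prop) (by fun_prop)
  · exact p.δ.def0_holds (g := fun q : (p.Z.Tuple × X.Tuple) × (Fin p.k → p.Y.Tuple) => q.2 i)
      (f := fun q => q.1.2) (by fun_prop) (by fun_prop)

/-- Finite þ-ranks with respect to a family of patterns, which may use variables of different
sorts. -/
def rankGE {J : Type*} (P : J → Pattern X) : ℕ → Set X.Tuple → Prop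
  | 0, D => D.Nonempty
  | n + 1, D => ∃ (j : J) (c : (P j).Z.Tuple),
      {a | a ∈ (P j).π.solutions c ∧ rankGE P n (D ∩ (P j).δ.solutions a)}.Infinite ∧
        (P j).Inconsistent c

variable {J : Type*} {P : J → Pattern X} {n : ℕ} {D D' : Set X.Tuple}

theorem rankGE.mono (h : rankGE P n D) (hD : D ⊆ D') : rankGE P n D' := by
  induction n generalizing D D' with
  | zero => exact Set.Nonempty.mono hD h
  | succ n ih =>
    obtain ⟨j, c, hinf, hc⟩ := h
    exact ⟨j, c, hinf.mono fun a ha => ⟨ha.1, ih ha.2 (Set.inter_subset_inter_left _ hD)⟩, hc⟩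

theorem rankGE.nonempty (h : rankGE P n D) : D.Nonempty := by
  induction n generalizing D with
  | zero => exact h
  | succ n ih =>
    obtain ⟨j, c, hinf, -⟩ := h
    obtain ⟨a, ha⟩ := hinf.nonempty
    exact (ih ha.2).mono Set.inter_subset_left

theorem rankGE.of_succ (h : rankGE P (n + 1) D) : rankGE P n D := by
  induction n generalizing D with
  | zero => exact h.nonempty
  | succ n ih =>
    obtain ⟨j, c, hinf, hc⟩ := h
    exact ⟨j, c, hinf.mono fun a ha => ⟨ha.1, ih ha.2⟩, hc⟩

theorem rankGE.anti {m : ℕ} (h : rankGE P n D) (hmn : m ≤ n) : rankGE P m D := by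
  induction n, hmn using Nat.le_induction with
  | base => exact h
  | succ n _ ih => exact ih h.of_succ

/-- The rank of a finite union is the maximum of the ranks. -/
theorem rankGE.exists_of_subset_iUnion {I : Type*} [Finite I] {F : I → Set X.Tuple}
    (h : rankGE P n D) (hD : D ⊆ ⋃ i, F i) : ∃ i, rankGE P n (D ∩ F i) := by
  induction n generalizing D with
  | zero =>
    obtain ⟨x, hx⟩ := h
    obtain ⟨i, hi⟩ := Set.mem_iUnion.1 (hD hx)
    exact ⟨i, x, hx, hi⟩
  | succ n ih =>
    obtain ⟨j, c, hinf, hc⟩ := h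
    have h1 : ∀ a ∈ {a | a ∈ (P j).π.solutions c ∧ rankGE P n (D ∩ (P j).δ.solutions a)},
        ∃ i, rankGE P n ((D ∩ (P j).δ.solutions a) ∩ F i) :=
      fun a ha => ih ha.2 (Set.inter_subset_left.trans hD)
    have h2 : {a | a ∈ (P j).π.solutions c ∧ rankGE P n (D ∩ (P j).δ.solutions a)} ⊆
        ⋃ i, {a | a ∈ (P j).π.solutions c ∧ rankGE P n ((D ∩ (P j).δ.solutions a) ∩ F i)} :=
      fun a ha => (h1 a ha).elim fun i hi => Set.mem_iUnion.2 ⟨i, ha.1, hi⟩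
    obtain ⟨i, hi⟩ : ∃ i,
        {a | a ∈ (P j).π.solutions c ∧ rankGE P n ((D ∩ (P j).δ.solutions a) ∩ F i)}.Infinite := by
      by_contra! hfin
      exact hinf ((Set.finite_iUnion fun i => hfin i).subset h2)
    refine ⟨i, j, c, hi.mono fun a ha => ⟨ha.1, ?_⟩, hc⟩
    rw [Set.inter_right_comm]
    exact ha.2

/-- If the rank with respect to finitely many patterns together is at least `∑ j, m j`, then for
some `j` the rank with respect to the `j`-th pattern alone is at least `m j`: a Ramsey-type
argument on the tree of formulas witnessing the rank. -/
theorem rankGE.exists_single [Fintype J] [Nonempty J] (m : J → ℕ)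
    (h : rankGE P (∑ j, m j) D) : ∃ j, rankGE (fun _ : Unit => P j) (m j) D := by
  classical
  obtain ⟨s, hs⟩ : ∃ s, s = ∑ j, m j := ⟨_, rfl⟩
  induction s generalizing m D with
  | zero =>
    obtain ⟨j⟩ := ‹Nonempty J›
    have : m j = 0 := Finset.sum_eq_zero_iff.1 hs.symm j (Finset.mem_univ j)
    exact ⟨j, this ▸ h.nonempty⟩
  | succ s ih =>
    rw [← hs] at h
    obtain ⟨j, c, hinf, hc⟩ := id h
    rcases Nat.eq_zero_or_pos (m j) with hj | hj
    · exact ⟨j, hj ▸ h.nonempty⟩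
    have hsum : s = ∑ i, Function.update m j (m j - 1) i := by
      rw [Finset.sum_update_of_mem (Finset.mem_univ j)]
      have := Finset.sum_update_of_mem (Finset.mem_univ j) m (m j)
      rw [Function.update_eq_self] at this
      omega
    have key : ∀ a ∈ {a | a ∈ (P j).π.solutions c ∧ rankGE P s (D ∩ (P j).δ.solutions a)},
        ∃ i, rankGE (fun _ : Unit => P i) (Function.update m j (m j - 1) i)
          (D ∩ (P j).δ.solutions a) := fun a ha => ih _ (hsum ▸ ha.2) hsum
    by_cases hall : ∀ a ∈ {a | a ∈ (P j).π.solutions c ∧ rankGE P s (D ∩ (P j).δ.solutions a)},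
        rankGE (fun _ : Unit => P j) (m j - 1) (D ∩ (P j).δ.solutions a)
    · refine ⟨j, ?_⟩
      rw [← Nat.sub_add_cancel hj]
      exact ⟨(), c, hinf.mono fun a ha => ⟨ha.1, hall a ha⟩, hc⟩
    · push Not at hall
      obtain ⟨a, ha, hna⟩ := hall
      obtain ⟨i, hi⟩ := key a ha
      have hij : i ≠ j := by
        rintro rfl
        rw [Function.update_self] at hi
        exact hna hi
      rw [Function.update_of_ne hij] at hi
      exact ⟨i, hi.mono Set.inter_subset_left⟩

/-- Finite þ-ranks are type-definable in the parameters of the formula. -/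
theorem typeDef_rankGE [Finite J] (hC : IsMonsterModel T C κ) (P : J → Pattern X) (n : ℕ)
    {R : X.Tuple → σ → Prop} (hR : Def0 fun p : X.Tuple × σ => R p.1 p.2) :
    TypeDef fun s => rankGE P n {x | R x s} := by
  induction n generalizing σ with
  | zero =>
    exact (Def0.ex (P := fun s x => R x s)
      (hR.comp (f := fun p : σ × X.Tuple => (p.2, p.1)) (by fun_prop))).typeDef
  | succ n ih =>
    refine TypeDef.exists_fin fun j => TypeDef.ex hC (P := fun s c => _ ∧ (P j).Inconsistent c) ?_
    refine TypeDef.and ?_ (((P j).def0_inconsistent.comp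
      (f := fun p : (P j).Z.Tuple × σ => p.1) (by fun_prop)).typeDef)
    refine TypeDef.infinite hC (P := fun a (p : (P j).Z.Tuple × σ) =>
      a ∈ (P j).π.solutions p.1 ∧ rankGE P n ({x | R x p.2} ∩ (P j).δ.solutions a)) ?_
    refine TypeDef.and ((P j).π.def0_holds (f := fun p : (P j).Y.Tuple × ((P j).Z.Tuple × σ) => p.1)
      (g := fun p => p.2.1) (by fun_prop) (by fun_prop)).typeDef ?_
    refine ih (R := fun x (p : (P j).Y.Tuple × ((P j).Z.Tuple × σ)) =>
      R x p.2.2 ∧ (P j).δ.holds x p.1) ?_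
    exact (hR.comp (f := fun p : X.Tuple × ((P j).Y.Tuple × ((P j).Z.Tuple × σ)) => (p.1, p.2.2.2))
      (by fun_prop)).and ((P j).δ.def0_holds (by fun_prop) (by fun_prop))

/-- The rank of `D ∩ δ(x, d)` depends only on the type of `d` over the parameters of `D`. -/
theorem rankGE_iff_of_sameType [Finite J] (hC : IsMonsterModel T C κ) (hD : DefOver A D)
    {Y : Ctx L C} (δ : EqFormula X Y) {d d' : Y.Tuple} (h : SameType A d d') :
    rankGE P n (D ∩ δ.solutions d) ↔ rankGE P n (D ∩ δ.solutions d') := by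
  obtain ⟨V, b, Q, hb, hQ, rfl⟩ := hD
  refine TypeDef.iff_of_sameType (P := fun d b => rankGE P n ({x | Q x b} ∩ δ.solutions d))
    (typeDef_rankGE hC P n (R := fun x (p : Y.Tuple × V.Tuple) => Q x p.2 ∧ δ.holds x p.1) ?_)
    (h.mono hb)
  exact (hQ.comp (f := fun p : X.Tuple × (Y.Tuple × V.Tuple) => (p.1, p.2.2))
    (by fun_prop)).and (δ.def0_holds (by fun_prop) (by fun_prop))

/-- A formula of infinite rank can be divided so that infinite rank is preserved, by a parameter
outside of the algebraic closure of any given small set. -/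
theorem exists_step_of_forall_rankGE [Finite J] (hC : IsMonsterModel T C κ)
    (hD : DefOver B D) (h : ∀ n, rankGE P n D) :
    ∃ (j : J) (c : (P j).Z.Tuple), (P j).Inconsistent c ∧ ∀ E : Set (Imag L C), #E < κ →
      ∃ a ∈ (P j).π.solutions c, ¬ Alg E a ∧ ∀ n, rankGE P n (D ∩ (P j).δ.solutions a) := by
  obtain ⟨V, b, Q, hb, hQ, rfl⟩ := hD
  choose g hg using fun n => h (n + 1)
  -- the first pattern can be chosen independently of `n`, as there are only finitely many
  obtain ⟨j, hj⟩ := Finite.exists_infinite_fiber g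
  have hj' : ∀ n, ∃ c, {a | a ∈ (P j).π.solutions c ∧
      rankGE P n ({x | Q x b} ∩ (P j).δ.solutions a)}.Infinite ∧ (P j).Inconsistent c := by
    intro n
    obtain ⟨m, hm, hnm⟩ := (Set.infinite_coe_iff.1 hj).exists_gt n
    obtain rfl : g m = j := hm
    obtain ⟨c, hinf, hc⟩ := hg m
    exact ⟨c, hinf.mono fun a ha => ⟨ha.1, ha.2.anti hnm.le⟩, hc⟩
  have htd : ∀ n, TypeDef fun p : (P j).Y.Tuple × ((P j).Z.Tuple × V.Tuple) =>
      p.1 ∈ (P j).π.solutions p.2.1 ∧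
        rankGE P n ({x | Q x p.2.2} ∩ (P j).δ.solutions p.1) := by
    intro n
    refine ((P j).π.def0_holds (by fun_prop) (by fun_prop)).typeDef.and
      (typeDef_rankGE hC P n (R := fun x (p : (P j).Y.Tuple × ((P j).Z.Tuple × V.Tuple)) =>
        Q x p.2.2 ∧ (P j).δ.holds x p.1) ?_)
    exact (hQ.comp (f := fun p : X.Tuple × ((P j).Y.Tuple × ((P j).Z.Tuple × V.Tuple)) =>
      (p.1, p.2.2.2)) (by fun_prop)).and ((P j).δ.def0_holds (by fun_prop) (by fun_prop))
  obtain ⟨c, hc⟩ := exists_forall_of_typeDef hC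
    (P := fun n c b => {a | a ∈ (P j).π.solutions c ∧
      rankGE P n ({x | Q x b} ∩ (P j).δ.solutions a)}.Infinite ∧ (P j).Inconsistent c)
    (fun n => ((htd n).infinite hC (P := fun a (p : (P j).Z.Tuple × V.Tuple) =>
      a ∈ (P j).π.solutions p.1 ∧ rankGE P n ({x | Q x p.2} ∩ (P j).δ.solutions a))).and
      (((P j).def0_inconsistent.comp
        (f := fun p : (P j).Z.Tuple × V.Tuple => p.1) (by fun_prop)).typeDef))
    (fun m n c hmn hc => ⟨hc.1.mono fun a ha => ⟨ha.1, ha.2.anti hmn⟩, hc.2⟩) hj'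
  refine ⟨j, c, (hc 0).2, fun E hE => ?_⟩
  obtain ⟨a, haE, ha⟩ := exists_not_alg_forall_of_typeDef hC
    (P := fun n a (p : (P j).Z.Tuple × V.Tuple) => a ∈ (P j).π.solutions p.1 ∧
      rankGE P n ({x | Q x p.2} ∩ (P j).δ.solutions a)) htd (s := (c, b))
    (fun m n a hmn ha => ⟨ha.1, ha.2.anti hmn⟩) (fun n => (hc n).1)
    (small_union_ents hC.aleph0_lt hE (c, b)) Set.subset_union_right
  exact ⟨a, (ha 0).1, fun hn => haE (hn.mono Set.subset_union_left), fun n => (ha n).2⟩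

end Rank

/-! ### The ordinal-valued þ-rank -/

section OrdinalRank

variable {L : FirstOrder.Language.{u, v}} {C : Type w} [L.Structure C]
variable {T : L.Theory} {κ : Cardinal.{w}} {B : Set (Imag L C)} {X Y Z : Ctx L C}
variable {Δ : Set (EqFormula X Y)} {Ps : Set (EqFormula Y Z)} {k : ℕ} {D : Set X.Tuple}

open Cardinal

theorem thornRankGE_zero : ThornRankGE Δ Ps k 0 D ↔ D.Nonempty := by
  rw [ThornRankGE, Ordinal.limitRecOn_zero]

theorem thornRankGE_succ {α : Ordinal.{w}} : ThornRankGE Δ Ps k (α + 1) D ↔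
    ∃ δ ∈ Δ, ∃ π ∈ Ps, ∃ c : Z.Tuple,
      {a : Y.Tuple | a ∈ π.solutions c ∧ ThornRankGE Δ Ps k α (D ∩ δ.solutions a)}.Infinite ∧
        IsInconsistentFamily δ (π.solutions c) k := by
  rw [ThornRankGE, Ordinal.limitRecOn_add_one]
  rfl

theorem thornRankGE_limit {α : Ordinal.{w}} (hα : Order.IsSuccLimit α) :
    ThornRankGE Δ Ps k α D ↔ ∀ β < α, ThornRankGE Δ Ps k β D := by
  rw [ThornRankGE, Ordinal.limitRecOn_limit (h := hα)]
  rfl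

/-- The patterns with formulas from `Δ` and `Ps`. -/
def patterns (Δ : Set (EqFormula X Y)) (Ps : Set (EqFormula Y Z)) (k : ℕ) : Δ × Ps → Pattern X :=
  fun j => ⟨Y, Z, j.1, j.2, k⟩

theorem rankGE_of_thornRankGE {n : ℕ} (h : ThornRankGE Δ Ps k n D) :
    rankGE (patterns Δ Ps k) n D := by
  induction n generalizing D with
  | zero => exact thornRankGE_zero.1 (by simpa using h)
  | succ n ih =>
    rw [Nat.cast_succ, thornRankGE_succ] at h
    obtain ⟨δ, hδ, π, hπ, c, hinf, hc⟩ := h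
    exact ⟨(⟨δ, hδ⟩, ⟨π, hπ⟩), c, hinf.mono fun a ha => ⟨ha.1, ih ha.2⟩, hc⟩

/-- If the rank is at least `n` for every natural number `n`, then it is undefined. -/
theorem thornRankGE_of_forall_rankGE (hC : IsMonsterModel T C κ) (hΔ : Δ.Finite) (hPs : Ps.Finite)
    (hD : DefOver B D) (h : ∀ n, rankGE (patterns Δ Ps k) n D) (α : Ordinal.{w}) :
    ThornRankGE Δ Ps k α D := by
  have := hΔ.to_subtype
  have := hPs.to_subtype
  induction α using Ordinal.limitRecOn generalizing B D with
  | zero => exact thornRankGE_zero.2 (h 0)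
  | add_one α ih =>
    obtain ⟨j, c, hc, hE⟩ := exists_step_of_forall_rankGE hC hD h
    refine thornRankGE_succ.2 ⟨j.1, j.1.2, j.2, j.2.2, c, ?_, hc⟩
    refine infinite_of_forall_exists_not_alg hC (E := ∅) (by
      rw [mk_eq_zero]; exact aleph0_pos.trans hC.aleph0_lt) fun E hsE _ => ?_
    obtain ⟨a, ha, haE, hr⟩ := hE E hsE
    refine ⟨a, ⟨ha, ?_⟩, haE⟩
    refine ih (B := B ∪ ents a) ((hD.mono Set.subset_union_left).inter ?_) hr
    exact DefOver.intro (P := fun x y => j.1.1.holds x y) j.1.1.def0 a Set.subset_union_right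
  | limit α hα ih =>
    exact (thornRankGE_limit hα).2 fun β hβ => ih β hβ hD h

end OrdinalRank

/-! ### Infinite rank implies failure of symmetry -/

section Asymmetry

variable {L : FirstOrder.Language.{u, v}} {C : Type w} [L.Structure C]
variable {τ : Type w} [ImTuple L C τ]
variable {T : L.Theory} {κ : Cardinal.{w}} {A B : Set (Imag L C)} {X Y Z : Ctx L C}

open Cardinal Filter

theorem EqFormula.defOver_solutions (φ : EqFormula X Y) {b : Y.Tuple} (hb : ents b ⊆ A) :
    DefOver A (φ.solutions b) := DefOver.intro (P := φ.holds) φ.def0 b hb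

theorem EqFormula.defOver_holds (φ : EqFormula X Y) {x : X.Tuple} (hx : ents x ⊆ A) :
    DefOver A {y | φ.holds x y} :=
  DefOver.intro (P := fun y x => φ.holds x y)
    (φ.def0_holds (f := fun p : Y.Tuple × X.Tuple => p.2) (g := fun p => p.1)
      (by fun_prop) (by fun_prop)) x hx

theorem DefOver.exists_of_monotone {D : Set τ} {F : ℕ → Set (Imag L C)} (hF : Monotone F)
    (h : DefOver (⋃ n, F n) D) : ∃ n, DefOver (F n) D := by
  obtain ⟨V, b, P, hb, hP, rfl⟩ := h
  obtain ⟨n, hn⟩ := (hF.directed_le).exists_mem_subset_of_finset_subset_biUnion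
    (s := (finite_ents b).toFinset) (by simpa using hb)
  exact ⟨n, .intro hP b (by simpa using hn)⟩

/-- No formula with a solution in the base `A` þ-forks over `A`: such a solution would satisfy
the infinitely many conjugates of a þ-dividing formula. -/
theorem not_thornForks_of_mem (hC : IsMonsterModel T C κ) (hA : #A < κ) {D : Set X.Tuple}
    {x : X.Tuple} (hx : ents x ⊆ A) (hxD : x ∈ D) : ¬ ThornForks D A := by
  rintro ⟨n, Y, δ, d, hdiv, hD⟩
  obtain ⟨i, hi⟩ := Set.mem_iUnion.1 (hD hxD)
  obtain ⟨Z, c, hna, k, hinc⟩ := hdiv i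
  rw [isAlgebraic_iff] at hna
  have hsmall : #(A ∪ entries c : Set _) < κ := by
    rw [entries_eq_ents]
    exact small_union_ents hC.aleph0_lt hA c
  refine not_isInconsistentFamily (x := x) ?_ (fun y hy => ?_) hinc
  · exact (infinite_sameType hC hsmall hna).mono fun y hy => mem_realizations_iff.2 hy
  · exact ((mem_realizations_iff.1 hy) _
      ((δ i).defOver_holds (hx.trans Set.subset_union_left))).1 hi

/-- An infinite sequence of parameters along which one formula divides, each parameter being
non-algebraic over the preceding ones, gives a failure of symmetry. A realization `s` of the limit
type of the sequence over the sequence `I` and the common solution `b` is þ-independent from `b`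
over `I`, being finitely satisfiable in `I`, while `b` is not þ-independent from `s`. -/
theorem not_thornSymmetric_of_sequence (hC : IsMonsterModel T C κ) (p : Pattern X)
    (a : ℕ → p.Y.Tuple) (c : ℕ → p.Z.Tuple) (b : X.Tuple) (hinc : ∀ n, p.Inconsistent (c n))
    (hac : ∀ n, a n ∈ p.π.solutions (c n)) (hb : ∀ n, p.δ.holds b (a n))
    (halg : ∀ n, ¬ Alg ((⋃ i < n, ents (a i, c i)) ∪ ents (c n)) (a n)) :
    ¬ ThornSymmetric L C κ := by
  set t : ℕ → (ctxOf (p.Y.Tuple × p.Z.Tuple)).Tuple := fun n => toCtx (a n, c n) with ht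
  set F : ℕ → Set (Imag L C) := fun n => ⋃ i < n, ents (a i, c i) with hFdef
  have hF : Monotone F := fun m n hmn => Set.biUnion_mono (fun i hi => lt_of_lt_of_le hi hmn)
    fun _ _ => le_rfl
  set I : Set (Imag L C) := ⋃ n, F n with hI
  have htI : ∀ n, ents (t n) ⊆ I := fun n => by
    rw [ht, ← entries_eq_ents, entries_toCtx]
    exact (Set.subset_biUnion_of_mem (s := {i | i < n + 1})
      (u := fun i => ents (a i, c i)) (Nat.lt_succ_self n)).trans
      (Set.subset_iUnion F (n + 1))
  have hsI : #I < κ := small_of_countable hC.aleph0_lt <| Set.countable_iUnion fun n =>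
    (Set.finite_lt_nat n).countable.biUnion fun i _ => (finite_ents _).countable
  obtain ⟨s, hs⟩ := exists_mem_sInter hC (small_union_ents hC.aleph0_lt hsI b)
    (F := {D | DefOver (I ∪ ents b) D ∧ ∀ᶠ n in (hyperfilter ℕ : Filter ℕ), t n ∈ D})
    (fun D hD => hD.1) (by
      intro S hS hfin
      have h : ∀ᶠ n in (hyperfilter ℕ : Filter ℕ), ∀ D ∈ S, t n ∈ D :=
        (eventually_all_finite hfin).2 fun D hD => (hS hD).2
      obtain ⟨n, hn⟩ := h.exists
      exact ⟨t n, hn⟩)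
  have hev : ∀ D, DefOver (I ∪ ents b) D → s ∈ D → ∀ᶠ n in (hyperfilter ℕ : Filter ℕ), t n ∈ D := by
    intro D hD hsD
    by_contra hn
    exact hs _ ⟨hD.compl, Ultrafilter.eventually_not.2 hn⟩ hsD
  -- four goals: `s` is independent from `b`, and the formula `δ(x, a)`, where `s = (a, c)`, is over
  -- `I` and `s`, is satisfied by `b`, and þ-forks over `I`
  intro hsym
  refine hsym I hsI _ _ s b ?_ (p.δ.solutions (toCtx.symm s).1) ?_ ?_ ?_
  · intro D hD hsD
    rw [definableOver_iff, entries_eq_ents] at hD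
    obtain ⟨n, hn⟩ := (hev D hD hsD).exists
    exact not_thornForks_of_mem hC hsI (htI n) hn
  · rw [definableOver_iff]
    refine p.δ.defOver_solutions (Set.subset_union_of_subset_right ?_ _)
    have h := ents_prod (toCtx.symm s).1 (toCtx.symm s).2
    rw [Prod.mk.eta, ← entries_toCtx, Equiv.apply_symm_apply] at h
    rw [h]
    exact Set.subset_union_left
  · refine hs {s | p.δ.holds b (toCtx.symm s).1} ⟨?_, Eventually.of_forall fun n => ?_⟩
    · exact (p.δ.defOver_holds Set.subset_union_right).preimage
        (Coord.fst (Coord.toCtx_symm Coord.id))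
    · simpa [ht] using hb n
  · refine ⟨1, fun _ => p.Y, fun _ => p.δ, fun _ => (toCtx.symm s).1, fun _ => ?_,
      fun x hx => Set.mem_iUnion.2 ⟨0, hx⟩⟩
    refine ⟨p.Z, (toCtx.symm s).2, ?_, p.k, ?_⟩
    · rw [isAlgebraic_iff, entries_eq_ents]
      rintro ⟨D, hD, haD, hfin⟩
      obtain ⟨R, hR, rfl⟩ := hD.exists_fiber
      obtain ⟨N, hN⟩ := hR.exists_of_monotone hF
      obtain ⟨m, hm⟩ := finite_iff_exists_not_many.1 hfin
      -- `W` says of `(a, c)` that `a` is one of fewer than `m` solutions of a formula over `F N, c`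
      have hW := hN.inter
        ((hN.many m).compl.preimage (f := fun q : p.Y.Tuple × p.Z.Tuple => q.2) (by fun_prop))
      have hW' := (hW.preimage (f := fun s => toCtx.symm s) (by fun_prop)).mono
        ((Set.subset_iUnion F N).trans (Set.subset_union_left (t := ents b)))
      have h1 := hev _ hW' ⟨haD, hm⟩
      have h2 : ∀ᶠ n in (hyperfilter ℕ : Filter ℕ), N ≤ n :=
        (Nat.hyperfilter_le_atTop) (eventually_ge_atTop N)
      obtain ⟨n, hn, hNn⟩ := (h1.and h2).exists
      simp only [ht, Set.mem_ofPred_eq, Equiv.symm_apply_apply] at hn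
      refine halg n (Alg.mono (A := F N ∪ ents (c n)) ⟨_, hN.fiber (c n), hn.1, ?_⟩
        (Set.union_subset_union_left _ (hF hNn)))
      exact finite_iff_exists_not_many.2 ⟨m, hn.2⟩
    · have hmem : (toCtx.symm s).1 ∈ p.π.solutions (toCtx.symm s).2 ∧
          p.Inconsistent (toCtx.symm s).2 := by
        refine hs {s | (toCtx.symm s).1 ∈ p.π.solutions (toCtx.symm s).2 ∧
          p.Inconsistent (toCtx.symm s).2} ⟨.of_def0 (Def0.and ?_ ?_),
            Eventually.of_forall fun n => ?_⟩
        · exact p.π.def0_holds (Coord.fst (Coord.toCtx_symm Coord.id))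
            (Coord.snd (Coord.toCtx_symm Coord.id))
        · exact p.def0_inconsistent.comp (Coord.snd (Coord.toCtx_symm Coord.id))
        · simpa [ht] using ⟨hac n, hinc n⟩
      refine hmem.2.mono fun y hy => ?_
      refine ((mem_realizations_iff.1 hy) _ (p.π.defOver_solutions ?_)).1 hmem.1
      rw [entries_eq_ents]
      exact Set.subset_union_right

/-- Symmetry fails as soon as the rank of some formula is at least `n` for every `n`. The sequence
required by `not_thornSymmetric_of_sequence` is built by iterating `exists_step_of_forall_rankGE`;
a state of the recursion is a set of infinite rank together with the parameters used so far. -/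
theorem not_thornSymmetric_of_forall_rankGE (hC : IsMonsterModel T C κ) {J : Type*} [Finite J]
    {P : J → Pattern X} {D : Set X.Tuple} (hB : #B < κ) (hD : DefOver B D)
    (h : ∀ n, rankGE P n D) : ¬ ThornSymmetric L C κ := by
  let S := {q : Set X.Tuple × Set (Imag L C) // DefOver q.2 q.1 ∧ #q.2 < κ ∧ ∀ n, rankGE P n q.1}
  have step : ∀ q : S, ∃ (r : S) (e : Σ j, (P j).Y.Tuple × (P j).Z.Tuple),
      (P e.1).Inconsistent e.2.2 ∧ e.2.1 ∈ (P e.1).π.solutions e.2.2 ∧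
      ¬ Alg (q.1.2 ∪ ents e.2.2) e.2.1 ∧ r.1.1 = q.1.1 ∩ (P e.1).δ.solutions e.2.1 ∧
      r.1.2 = q.1.2 ∪ ents e.2 := by
    rintro ⟨⟨D, B⟩, hD, hB, h⟩
    obtain ⟨j, c, hc, hE⟩ := exists_step_of_forall_rankGE hC hD h
    obtain ⟨a, ha, haE, hr⟩ := hE _ (small_union_ents hC.aleph0_lt hB c)
    refine ⟨⟨(D ∩ (P j).δ.solutions a, B ∪ ents (a, c)),
      (hD.mono Set.subset_union_left).inter ((P j).δ.defOver_solutions ?_),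
      small_union_ents hC.aleph0_lt hB _, hr⟩, ⟨j, a, c⟩, hc, ha, haE, rfl, rfl⟩
    exact Set.subset_union_of_subset_right ((ents_prod a c).symm ▸ Set.subset_union_left) _
  choose next e hinc hmem halg hD' hB' using step
  let q : ℕ → S := fun n => next^[n] ⟨(D, B), hD, hB, h⟩
  have hq : ∀ n, q (n + 1) = next (q n) := fun n => Function.iterate_succ_apply' _ _ _
  have hBn : ∀ n, ⋃ i < n, ents (e (q i)).2 ⊆ (q n).1.2 := by
    intro n
    induction n with
    | zero => simp
    | succ n ih =>
      rw [Set.biUnion_lt_succ, hq, hB']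
      exact Set.union_subset_union_left _ ih
  have hDn : ∀ n, (q n).1.1 ⊆ ⋂ i < n, (P (e (q i)).1).δ.solutions (e (q i)).2.1 := by
    intro n
    induction n with
    | zero => simp
    | succ n ih =>
      rw [Set.biInter_lt_succ, hq, hD']
      exact Set.inter_subset_inter_left _ ih
  obtain ⟨b, hb⟩ := exists_mem_iInter hC (A := ⋃ n, ents (e (q n)).2.1)
    (small_of_countable hC.aleph0_lt (Set.countable_iUnion fun n => (finite_ents _).countable))
    (D := fun n => (P (e (q n)).1).δ.solutions (e (q n)).2.1)
    (fun n => (P (e (q n)).1).δ.defOver_solutions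
      (Set.subset_iUnion (fun n => ents (e (q n)).2.1) n)) (fun s => by
        obtain ⟨x, hx⟩ := (((q (s.sup id + 1)).2.2.2) 0).nonempty
        refine ⟨x, Set.mem_iInter₂.2 fun i hi => Set.mem_iInter₂.1 (hDn _ hx) i ?_⟩
        exact Nat.lt_succ_of_le (Finset.le_sup (f := id) hi))
  -- pass to a subsequence along which the pattern is constant
  obtain ⟨j, hj⟩ := Finite.exists_infinite_fiber fun n => (e (q n)).1
  have hj' := Set.infinite_coe_iff.1 hj
  obtain ⟨f, hf, hfj⟩ : ∃ f : ℕ → ℕ, StrictMono f ∧ ∀ n, (e (q (f n))).1 = j :=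
    ⟨Nat.nth _, Nat.nth_strictMono hj', fun n => Nat.nth_mem_of_infinite hj' n⟩
  -- the dependent pairs `e (q (f n))` all live over the same pattern `j`
  have hex : ∀ n, ∃ y : (P j).Y.Tuple × (P j).Z.Tuple, e (q (f n)) = ⟨j, y⟩ := by
    intro n
    have h1 := hfj n
    generalize e (q (f n)) = z at h1
    obtain ⟨i, y⟩ := z
    obtain rfl : i = j := h1
    exact ⟨y, rfl⟩
  choose y hy using hex
  refine not_thornSymmetric_of_sequence hC (P j) (fun n => (y n).1) (fun n => (y n).2) b
    (fun n => ?_) (fun n => ?_) (fun n => ?_) (fun n => ?_)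
  · have h1 := hinc (q (f n))
    rwa [hy n] at h1
  · have h1 := hmem (q (f n))
    rwa [hy n] at h1
  · have h1 := Set.mem_iInter.1 hb (f n)
    rwa [hy n] at h1
  · have h1 := halg (q (f n))
    rw [hy n] at h1
    refine fun hn => h1 (hn.mono (Set.union_subset_union_left _ ?_))
    refine Set.Subset.trans (Set.iUnion₂_subset fun i hi => ?_) (hBn (f n))
    have h2 := Set.subset_biUnion_of_mem (u := fun i => ents (e (q i)).2) (s := {i | i < f n})
      (hf hi)
    beta_reduce at h2
    rwa [hy i] at h2

end Asymmetry

/-! ### Failure of symmetry implies infinite rank -/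

section Symmetry

variable {L : FirstOrder.Language.{u, v}} {C : Type w} [L.Structure C]
variable {τ : Type w} [ImTuple L C τ]
variable {T : L.Theory} {κ : Cardinal.{w}} {A B B' : Set (Imag L C)} {X U : Ctx L C}

open Cardinal

theorem thornForks_iff {D : Set X.Tuple} : ThornForks D A ↔
    ∃ F : Set (Set X.Tuple), F.Finite ∧ D ⊆ ⋃₀ F ∧ ∀ S ∈ F, ∃ (Y : Ctx L C) (δ : EqFormula X Y)
      (d : Y.Tuple), ThornDivides δ d A ∧ S = δ.solutions d := by
  constructor
  · rintro ⟨n, Y, δ, d, hdiv, hD⟩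
    refine ⟨Set.range fun i => (δ i).solutions (d i), Set.finite_range _, by rwa [Set.sUnion_range],
      ?_⟩
    rintro _ ⟨i, rfl⟩
    exact ⟨Y i, δ i, d i, hdiv i, rfl⟩
  · rintro ⟨F, hF, hD, hdiv⟩
    have := hF.to_subtype
    obtain ⟨n, ⟨e⟩⟩ := Finite.exists_equiv_fin F
    choose Y δ d hdiv hS using fun i => hdiv _ (e.symm i).2
    refine ⟨n, Y, δ, d, hdiv, fun x hx => ?_⟩
    obtain ⟨S, hS', hxS⟩ := hD hx
    refine Set.mem_iUnion.2 ⟨e ⟨S, hS'⟩, ?_⟩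
    rw [← hS]
    simpa using hxS

theorem ThornForks.of_subset_sUnion {D : Set X.Tuple} {G : Set (Set X.Tuple)} (hG : G.Finite)
    (h : ∀ S ∈ G, ThornForks S A) (hD : D ⊆ ⋃₀ G) : ThornForks D A := by
  simp only [thornForks_iff] at h ⊢
  choose! F hF hsub hdiv using h
  refine ⟨⋃ S ∈ G, F S, hG.biUnion hF, fun x hx => ?_, fun S hS => ?_⟩
  · obtain ⟨S, hS, hxS⟩ := hD hx
    obtain ⟨E, hE, hxE⟩ := hsub S hS hxS
    exact ⟨E, Set.mem_biUnion hS hE, hxE⟩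
  · obtain ⟨E, hE, hS⟩ := Set.mem_iUnion₂.1 hS
    exact hdiv E hE S hS

/-- `ThornIndep` with an arbitrary set `B` on the right: no formula in `tp(a/AB)` þ-forks
over `A`. -/
def IndepFrom (A : Set (Imag L C)) (a : X.Tuple) (B : Set (Imag L C)) : Prop :=
  ∀ D : Set X.Tuple, DefOver (A ∪ B) D → a ∈ D → ¬ ThornForks D A

theorem thornIndep_iff {Y : Ctx L C} {a : X.Tuple} {b : Y.Tuple} :
    ThornIndep A a b ↔ IndepFrom A a (ents b) := by
  simp only [ThornIndep, IndepFrom, definableOver_iff, entries_eq_ents]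

theorem IndepFrom.mono {a : X.Tuple} (h : IndepFrom A a B) (hB : B' ⊆ B) : IndepFrom A a B' :=
  fun D hD => h D (hD.mono (Set.union_subset_union_right _ hB))

/-- Extension: types that do not þ-fork over `A` extend to larger sets of parameters. -/
theorem IndepFrom.exists_extension (hC : IsMonsterModel T C κ) (hA : #A < κ) (hB : #B < κ)
    {a : X.Tuple} (h : IndepFrom A a B) (hB' : #B' < κ) :
    ∃ a', SameType (A ∪ B) a a' ∧ IndepFrom A a' (B ∪ B') := by
  have hsub : A ∪ B ⊆ A ∪ (B ∪ B') := Set.union_subset_union_right _ Set.subset_union_left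
  obtain ⟨a', ha'⟩ := exists_mem_sInter hC
    (small_union hC.aleph0_lt hA (small_union hC.aleph0_lt hB hB'))
    (F := {D | DefOver (A ∪ B) D ∧ a ∈ D} ∪ {D | DefOver (A ∪ (B ∪ B')) D ∧ ThornForks Dᶜ A})
    (by rintro D (hD | hD); exacts [hD.1.mono hsub, hD.1]) (by
      intro S hS hfin
      -- otherwise a formula of `tp(a/AB)` is covered by finitely many þ-forking formulas
      by_contra hempty
      refine h (⋂₀ {D ∈ S | DefOver (A ∪ B) D ∧ a ∈ D}) ?_ (fun D hD => hD.2.2) ?_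
      · exact .sInter (hfin.subset (Set.sep_subset _ _)) fun D hD => hD.2.1
      refine .of_subset_sUnion (G := compl '' {D ∈ S | ThornForks Dᶜ A})
        ((hfin.subset (Set.sep_subset _ _)).image _) (by rintro _ ⟨D, hD, rfl⟩; exact hD.2) ?_
      intro x hx
      by_contra hx'
      refine hempty ⟨x, fun D hD => ?_⟩
      rcases hS hD with h1 | h1
      · exact hx D ⟨hD, h1⟩
      · by_contra hxD
        exact hx' ⟨Dᶜ, ⟨D, ⟨hD, h1.2⟩, rfl⟩, hxD⟩)
  refine ⟨a', .of_imp fun D hD haD => ha' D (Or.inl ⟨hD, haD⟩), fun D hD haD hfork => ?_⟩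
  exact ha' Dᶜ (Or.inr ⟨hD.compl, by rwa [compl_compl]⟩) haD

/-- A þ-independent tuple `e` does not make `p` algebraic: a formula saying that `p` is one of
fewer than `m` solutions of a formula with parameter `e` þ-divides when read as a formula about
`e`. -/
theorem IndepFrom.not_alg {p : τ} {e : U.Tuple} (h : IndepFrom A e (B ∪ ents p))
    (hp : ¬ Alg (A ∪ B) p) : ¬ Alg (A ∪ B ∪ ents e) p := by
  rintro ⟨D, hD, hpD, hfin⟩
  obtain ⟨_, ⟨V, b, Q, hb, hQ, rfl⟩, rfl⟩ := hD.exists_fiber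
  obtain ⟨m, hm⟩ := finite_iff_exists_not_many.1 hfin
  -- the formula about `x` with parameters `(p, b)`, strongly dividing over `A` and `b`
  let P : U.Tuple → τ × V.Tuple → Prop := fun x q =>
    Q (q.1, x) q.2 ∧ ¬ ∃ f : Fin m → τ, f.Injective ∧ ∀ i, Q (f i, x) q.2
  have hP : Def0 fun q : U.Tuple × (τ × V.Tuple) => P q.1 q.2 := by
    refine Def0.and ?_ (Def0.not ?_)
    · exact hQ.comp (f := fun q : U.Tuple × (τ × V.Tuple) => ((q.2.1, q.1), q.2.2)) (by fun_prop)
    · refine Def0.comp (P := fun s : U.Tuple × V.Tuple =>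
        ∃ f : Fin m → τ, f.Injective ∧ ∀ i, Q (f i, s.1) s.2)
        (f := fun q : U.Tuple × (τ × V.Tuple) => (q.1, q.2.2)) ?_ (by fun_prop)
      exact Def0.many (P := fun t (s : U.Tuple × V.Tuple) => Q (t, s.1) s.2)
        (hQ.comp (f := fun q : τ × (U.Tuple × V.Tuple) => ((q.1, q.2.1), q.2.2)) (by fun_prop)) m
  have hents : ents (p, b) ⊆ A ∪ (B ∪ ents p) := by
    rw [ents_prod, ← Set.union_assoc]
    exact Set.union_subset Set.subset_union_right (hb.trans Set.subset_union_left)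
  refine h {x | P x (p, b)} (.intro hP _ hents) ⟨hpD, hm⟩ ?_
  refine ⟨1, fun _ => ctxOf (τ × V.Tuple), fun _ => mkFormula P hP, fun _ => toCtx (p, b),
    fun _ => ⟨V, b, ?_, m, ?_⟩, fun x hx => Set.mem_iUnion.2 ⟨0, ?_⟩⟩
  · rw [isAlgebraic_iff, entries_eq_ents]
    intro halg
    have := (halg.map (Coord.toCtx_symm Coord.id)).map (Coord.fst Coord.id)
    rw [Equiv.symm_apply_apply] at this
    exact hp (this.mono (Set.union_subset Set.subset_union_left hb))
  · rw [isInconsistentFamily_iff, entries_eq_ents]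
    rintro ⟨x, f, hf, hfx⟩
    rcases Nat.eq_zero_or_pos m with rfl | hpos
    · exact hm ⟨Fin.elim0, fun i => i.elim0, fun i => i.elim0⟩
    have hsnd : ∀ i, (toCtx.symm (f i)).2 = b := by
      intro i
      refine ((mem_realizations_iff.1 (hfx i).1) _ (DefOver.eq_const b Set.subset_union_right
        (Coord.snd (Coord.toCtx_symm Coord.id)))).1 ?_
      simp
    refine (hfx ⟨0, hpos⟩).2.2 ⟨fun i => (toCtx.symm (f i)).1, fun i j hij => ?_, fun i => ?_⟩
    · exact hf (toCtx.symm.injective (Prod.ext hij ((hsnd i).trans (hsnd j).symm)))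
    · have := (hfx i).2.1
      rw [hsnd] at this ⊢
      exact this
  · change P x (toCtx.symm (toCtx (p, b)))
    rwa [Equiv.symm_apply_apply]

/-- By compactness, þ-dividing over `A` is witnessed by a single formula `π(y, c)` of the type of
the parameter, where `c` may have entries in `A`. -/
theorem ThornDivides.exists_pattern (hC : IsMonsterModel T C κ) (hA : #A < κ) {Y : Ctx L C}
    {δ : EqFormula X Y} {d : Y.Tuple} (h : ThornDivides δ d A) :
    ∃ (p : Pattern X) (y : p.Y.Tuple) (c : p.Z.Tuple), δ.solutions d = p.δ.solutions y ∧
      y ∈ p.π.solutions c ∧ p.Inconsistent c ∧ ¬ Alg (A ∪ ents c) y := by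
  obtain ⟨Z, c, hna, k, hinc⟩ := h
  rw [isAlgebraic_iff, entries_eq_ents] at hna
  rw [entries_eq_ents] at hinc
  obtain ⟨S, hS, hdS, hSinc⟩ : ∃ S, DefOver (A ∪ ents c) S ∧ d ∈ S ∧
      IsInconsistentFamily δ S k := by
    by_contra! hn
    obtain ⟨q, hq⟩ := exists_mem_iInter hC (small_union_ents hC.aleph0_lt hA c)
      (J := {S : Set Y.Tuple // DefOver (A ∪ ents c) S ∧ d ∈ S})
      (D := fun S => {q : X.Tuple × (Fin k → Y.Tuple) |
        q.2.Injective ∧ (∀ i, δ.holds q.1 (q.2 i)) ∧ ∀ i, q.2 i ∈ S.1})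
      (fun S => by
        have h1 : DefOver (A ∪ ents c) {q : X.Tuple × (Fin k → Y.Tuple) |
            q.2.Injective ∧ ∀ i, δ.holds q.1 (q.2 i)} := by
          refine .of_def0 ((Def0.injective fun i => by fun_prop).and (Def0.forall_fin fun i => ?_))
          exact δ.def0_holds (f := fun q : X.Tuple × (Fin k → Y.Tuple) => q.1)
            (g := fun q => q.2 i) (by fun_prop) (by fun_prop)
        have h2 : DefOver (A ∪ ents c) (⋂ i, {q : X.Tuple × (Fin k → Y.Tuple) | q.2 i ∈ S.1}) :=
          .iInter fun i => S.2.1.preimage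
            (f := fun q : X.Tuple × (Fin k → Y.Tuple) => q.2 i) (by fun_prop)
        convert! h1.inter h2 using 1
        ext q
        simp [and_assoc]) (fun s => by
        have h1 := hn (⋂ S ∈ s, S.1) (.biInter s.finite_toSet fun S _ => S.2.1)
          (Set.mem_iInter₂.2 fun S _ => S.2.2)
        rw [isInconsistentFamily_iff, not_not] at h1
        obtain ⟨x, f, hf, hfS⟩ := h1
        exact ⟨(x, f), Set.mem_iInter₂.2 fun S hS => ⟨hf, fun i => (hfS i).2,
          fun i => Set.mem_iInter₂.1 (hfS i).1 S hS⟩⟩)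
    have hq' := fun S hS => Set.mem_iInter.1 hq ⟨S, hS⟩
    have h0 := hq' Set.univ ⟨.univ, trivial⟩
    refine isInconsistentFamily_iff.1 hinc ⟨q.1, q.2, h0.1, fun i => ⟨?_, h0.2.1 i⟩⟩
    exact mem_realizations_iff.2 (.of_imp fun D hD hdD => (hq' D ⟨hD, hdD⟩).2.2 i)
  obtain ⟨V, r, Q, hr, hQ, rfl⟩ := hS
  exact ⟨⟨Y, V, δ, ⟨Q, def0_iff_definable.1 hQ⟩, k⟩, d, r, rfl, hdS, hSinc,
    fun halg => hna (halg.mono (Set.union_subset Set.subset_union_left hr))⟩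

/-- The tuple `w = (d_j, c_j)_j` witnesses that the formula `R(x, u)` þ-forks over `A` along the
patterns `P j`, with each `d_j` non-algebraic even over `A`, `B` and `c_j`. -/
structure ForksAlong {n : ℕ} (A B : Set (Imag L C)) (R : Set (X.Tuple × U.Tuple))
    (P : Fin n → Pattern X) (u : U.Tuple) (w : ∀ j, (P j).Y.Tuple × (P j).Z.Tuple) : Prop where
  covers : ∀ x, (x, u) ∈ R → ∃ j, (P j).δ.holds x (w j).1
  mem : ∀ j, (P j).π.holds (w j).1 (w j).2 ∧ (P j).Inconsistent (w j).2
  not_alg : ∀ j, ¬ Alg (A ∪ B ∪ ents (w j).2) (w j).1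

section ForksAlong

variable {n : ℕ} {R : Set (X.Tuple × U.Tuple)} {P : Fin n → Pattern X} {u u' : U.Tuple}
  {w w' : ∀ j, (P j).Y.Tuple × (P j).Z.Tuple}

/-- The conditions in `ForksAlong` other than non-algebraicity are definable over `A`. -/
theorem defOver_covers_mem (hR : DefOver A R) :
    DefOver A {q : U.Tuple × (∀ j, (P j).Y.Tuple × (P j).Z.Tuple) |
      (∀ x, (x, q.1) ∈ R → ∃ j, (P j).δ.holds x (q.2 j).1) ∧
      ∀ j, (P j).π.holds (q.2 j).1 (q.2 j).2 ∧ (P j).Inconsistent (q.2 j).2} := by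
  have h1 : DefOver A {q : (U.Tuple × (∀ j, (P j).Y.Tuple × (P j).Z.Tuple)) × X.Tuple |
      (q.2, q.1.1) ∈ R} :=
    hR.preimage (f := fun q : (U.Tuple × (∀ j, (P j).Y.Tuple × (P j).Z.Tuple)) × X.Tuple =>
      (q.2, q.1.1)) (by fun_prop)
  have h2 : DefOver A {q : (U.Tuple × (∀ j, (P j).Y.Tuple × (P j).Z.Tuple)) × X.Tuple |
      ∃ j, (P j).δ.holds q.2 (q.1.2 j).1} :=
    .of_def0 (Def0.exists_fin fun j => (P j).δ.def0_holds
      (f := fun q : (U.Tuple × (∀ j, (P j).Y.Tuple × (P j).Z.Tuple)) × X.Tuple => q.2)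
      (g := fun q => (q.1.2 j).1) (by fun_prop) (by fun_prop))
  have h3 : DefOver A {q : U.Tuple × (∀ j, (P j).Y.Tuple × (P j).Z.Tuple) |
      ∀ j, (P j).π.holds (q.2 j).1 (q.2 j).2 ∧ (P j).Inconsistent (q.2 j).2} := by
    refine .of_def0 (Def0.forall_fin fun j => Def0.and ?_ ?_)
    · exact (P j).π.def0_holds
        (f := fun q : U.Tuple × (∀ j, (P j).Y.Tuple × (P j).Z.Tuple) => (q.2 j).1)
        (g := fun q => (q.2 j).2) (by fun_prop) (by fun_prop)
    · exact (P j).def0_inconsistent.comp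
        (f := fun q : U.Tuple × (∀ j, (P j).Y.Tuple × (P j).Z.Tuple) => (q.2 j).2) (by fun_prop)
  convert! (h1.compl.union h2).all.inter h3 using 1
  ext q
  simp [imp_iff_not_or]

/-- Witnesses of þ-forking can be moved along with the parameter. -/
theorem ForksAlong.of_sameType (hR : DefOver A R) (h : ForksAlong A B R P u w)
    (hs : SameType (A ∪ B) (u, w) (u', w')) : ForksAlong A B R P u' w' := by
  obtain ⟨h1, h2⟩ := (hs _ ((defOver_covers_mem hR).mono Set.subset_union_left)).1 ⟨h.covers, h.mem⟩
  refine ⟨h1, h2, fun j halg => h.not_alg j (Alg.of_sameType (SameType.symm ?_) halg)⟩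
  exact hs.map (f := fun q : U.Tuple × (∀ j, (P j).Y.Tuple × (P j).Z.Tuple) =>
    ((q.2 j).1, (q.2 j).2)) (by fun_prop)

/-- If `e` is þ-independent from `uB` over `A`, then witnesses that are non-algebraic over `B` can
be replaced by witnesses that are non-algebraic over `B` and `e`. A copy `e'` of `e` that is
independent from the given witnesses as well leaves them non-algebraic; moving `e'` back to `e`
over `uB` moves the witnesses to the required ones. -/
theorem ForksAlong.exists_union (hC : IsMonsterModel T C κ) (hA : #A < κ) (hB : #B < κ)
    (hR : DefOver A R) (h : ForksAlong A B R P u w) {V : Ctx L C} {e : V.Tuple}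
    (he : IndepFrom A e (ents u ∪ B)) :
    ∃ w', ForksAlong A (B ∪ ents e) R P u w' := by
  have huB := small_union hC.aleph0_lt (small_ents hC.aleph0_lt u) hB
  obtain ⟨e', hee', he'⟩ := he.exists_extension hC hA huB (small_ents hC.aleph0_lt w)
  obtain ⟨w', hw'⟩ := hee'.symm.exists_pair hC (small_union hC.aleph0_lt hA huB) w
  have hww' : SameType (A ∪ (ents u ∪ B)) w w' :=
    hw'.map (f := fun q : V.Tuple × (∀ j, (P j).Y.Tuple × (P j).Z.Tuple) => q.2) (by fun_prop)
  obtain ⟨h1, h2⟩ := (hww' _ ((((defOver_covers_mem hR).preimage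
    (f := fun q : (∀ j, (P j).Y.Tuple × (P j).Z.Tuple) × U.Tuple => (q.2, q.1))
      (by fun_prop)).fiber u).mono
    (Set.union_subset_union_right _ Set.subset_union_left))).1 ⟨h.covers, h.mem⟩
  refine ⟨w', h1, h2, fun j halg => ?_⟩
  have hsame : SameType (A ∪ B) ((w' j).1, ((w' j).2, e)) ((w j).1, ((w j).2, e')) :=
    (hw'.symm.mono (Set.union_subset_union_right _ Set.subset_union_right)).map
      (f := fun q : V.Tuple × (∀ j, (P j).Y.Tuple × (P j).Z.Tuple) =>
        ((q.2 j).1, ((q.2 j).2, q.1))) (by fun_prop)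
  have halg' : Alg (A ∪ B ∪ ents ((w j).2, e')) (w j).1 := by
    refine Alg.of_sameType hsame (halg.mono ?_)
    rw [ents_prod]
    intro x
    simp only [Set.mem_union]
    tauto
  have hwj : ents (w j) ⊆ ents w := by
    rw [ents_pi]
    exact Set.subset_iUnion (fun j => ents (w j)) j
  have hwj' : ents (w j).1 ∪ ents (w j).2 ⊆ ents w := ents_prod (w j).1 (w j).2 ▸ hwj
  refine IndepFrom.not_alg (A := A) (B := B ∪ ents (w j).2) (p := (w j).1) (e := e')
    (he'.mono ?_) ?_ (halg'.mono ?_)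
  · intro x hx
    have := @hwj' x
    simp only [Set.mem_union] at this hx ⊢
    tauto
  · rw [← Set.union_assoc]
    exact h.not_alg j
  · rw [ents_prod]
    intro x
    simp only [Set.mem_union]
    tauto

/-- If each `R(x, e i)` þ-forks over `A` along fixed patterns with witnesses that are non-algebraic
over the later elements of the sequence `e`, then a formula satisfied by `b` over `A` and
`e m, …, e (N - 1)` has rank at least `m`: adjoining `e (m - 1), …, e 0` to the parameters lowers
the rank at each step. -/
theorem rankGE_of_forksAlong (hC : IsMonsterModel T C κ) (hA : #A < κ) (hR : DefOver A R)
    {e : ℕ → U.Tuple} {b : X.Tuple} (hb : ∀ i, (b, e i) ∈ R) {N : ℕ}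
    (hw : ∀ i < N, ∃ w, ForksAlong A (⋃ l ∈ Set.Ico (i + 1) N, ents (e l)) R P (e i) w) {m : ℕ}
    (hm : m ≤ N) {D : Set X.Tuple} (hD : DefOver (A ∪ ⋃ l ∈ Set.Ico m N, ents (e l)) D)
    (hbD : b ∈ D) : rankGE P m D := by
  induction m generalizing D with
  | zero => exact ⟨b, hbD⟩
  | succ m ih =>
    obtain ⟨w, hw⟩ := hw m hm
    have hRm : DefOver (A ∪ ⋃ l ∈ Set.Ico m N, ents (e l)) {x | (x, e m) ∈ R} :=
      (hR.fiber (e m)).mono (Set.union_subset_union_right _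
        (Set.subset_biUnion_of_mem (u := fun l => ents (e l)) (Set.left_mem_Ico.2 hm)))
    have hD' : DefOver (A ∪ ⋃ l ∈ Set.Ico m N, ents (e l)) D :=
      hD.mono (Set.union_subset_union_right _
        (Set.biUnion_subset_biUnion_left (Set.Ico_subset_Ico_left m.le_succ)))
    have h1 := ih (m.le_succ.trans hm) (hD'.inter hRm) ⟨hbD, hb m⟩
    obtain ⟨j, hj⟩ := h1.exists_of_subset_iUnion (F := fun j => (P j).δ.solutions (w j).1)
      fun x hx => Set.mem_iUnion.2 (hw.covers x hx.2)
    have hj' : rankGE P m (D ∩ (P j).δ.solutions (w j).1) :=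
      hj.mono (Set.inter_subset_inter_left _ Set.inter_subset_left)
    refine ⟨j, (w j).2, (infinite_sameType hC ?_ (hw.not_alg j)).mono fun y hy => ⟨?_, ?_⟩,
      (hw.mem j).2⟩
    · refine small_union_ents hC.aleph0_lt (small_union hC.aleph0_lt hA ?_) _
      exact small_of_countable hC.aleph0_lt
        ((Set.finite_Ico _ _).countable.biUnion fun l _ => (finite_ents _).countable)
    · exact (hy _ ((P j).π.defOver_solutions Set.subset_union_right)).1 (hw.mem j).1
    · exact (rankGE_iff_of_sameType hC hD (P j).δ (hy.mono Set.subset_union_left)).1 hj'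

end ForksAlong

/-- A þ-independent type has a sequence of realizations each of which is þ-independent from the
preceding ones. -/
theorem IndepFrom.exists_sequence (hC : IsMonsterModel T C κ) (hA : #A < κ) (hB : #B < κ)
    {a : X.Tuple} (h : IndepFrom A a B) : ∃ e : ℕ → X.Tuple, ∀ n, SameType (A ∪ B) a (e n) ∧
      IndepFrom A (e n) (⋃ i ∈ Set.Iio n, ents (e i)) := by
  choose f hf hf' using fun S : {S : Set (Imag L C) // #S < κ} => h.exists_extension hC hA hB S.2
  let s : ℕ → {S : Set (Imag L C) // #S < κ} := fun n =>
    (fun S => ⟨S.1 ∪ ents (f S), small_union_ents hC.aleph0_lt S.2 _⟩)^[n]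
      ⟨∅, small_of_countable hC.aleph0_lt Set.countable_empty⟩
  have hs : ∀ n, (s (n + 1)).1 = (s n).1 ∪ ents (f (s n)) := fun n => by
    simp only [s, Function.iterate_succ_apply']
  have hsub : ∀ n, ⋃ i ∈ Set.Iio n, ents (f (s i)) ⊆ (s n).1 := by
    intro n
    induction n with
    | zero => simp
    | succ n ih =>
      rw [hs]
      refine Set.iUnion₂_subset fun i hi => ?_
      rcases Nat.lt_succ_iff_lt_or_eq.1 hi with hi | rfl
      · exact (Set.subset_biUnion_of_mem (u := fun i => ents (f (s i))) (s := Set.Iio n) hi).trans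
          (ih.trans Set.subset_union_left)
      · exact Set.subset_union_right
  exact ⟨fun n => f (s n), fun n => ⟨hf _, (hf' _).mono
    ((hsub n).trans Set.subset_union_right)⟩⟩

/-- The rank only depends on which patterns occur in the family. -/
theorem rankGE.of_forall_exists {J J' : Type*} {P : J → Pattern X} {P' : J' → Pattern X}
    (hP : ∀ j, ∃ j', P j = P' j') {n : ℕ} {D : Set X.Tuple} (h : rankGE P n D) :
    rankGE P' n D := by
  induction n generalizing D with
  | zero => exact h
  | succ n ih =>
    obtain ⟨j, c, hinf, hc⟩ := h
    obtain ⟨j', hj⟩ := hP j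
    generalize P j = p at hj c hinf hc
    subst hj
    exact ⟨j', c, hinf.mono fun a ha => ⟨ha.1, ih ha.2⟩, hc⟩

/-- A failure of symmetry gives a single pattern for which the rank is infinite. -/
theorem exists_forall_rankGE_of_not_indep (hC : IsMonsterModel T C κ) (hA : #A < κ) {a : U.Tuple}
    {b : X.Tuple} (hab : IndepFrom A a (ents b)) (hba : ¬ IndepFrom A b (ents a)) :
    ∃ p : Pattern X, ∀ m, rankGE (fun _ : Unit => p) m Set.univ := by
  simp only [IndepFrom, not_forall, not_not] at hba
  obtain ⟨D, hD, hbD, n, Y, δ, d, hdiv, hcov⟩ := hba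
  obtain ⟨R, hR, rfl⟩ := hD.exists_fiber
  choose P y c hsol hmem hinc halg using fun i => (hdiv i).exists_pattern hC hA
  have hw0 : ForksAlong A ∅ R P a fun j => (y j, c j) := by
    refine ⟨fun x hx => ?_, fun j => ⟨hmem j, hinc j⟩, fun j => by simpa using halg j⟩
    obtain ⟨j, hj⟩ := Set.mem_iUnion.1 (hcov hx)
    exact ⟨j, (hsol j ▸ hj : x ∈ (P j).δ.solutions (y j))⟩
  obtain ⟨e, he⟩ := hab.exists_sequence hC hA (small_ents hC.aleph0_lt b)
  have hbe : ∀ i, (b, e i) ∈ R := fun i =>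
    ((he i).1 _ ((hR.preimage (f := fun q : U.Tuple × X.Tuple => (q.2, q.1))
      (by fun_prop)).fiber b)).1 hbD
  have hw : ∀ N, ∀ i < N, ∃ w, ForksAlong A (⋃ l ∈ Set.Ico (i + 1) N, ents (e l)) R P (e i) w := by
    intro N
    induction N with
    | zero => simp
    | succ N ih =>
      intro i hi
      rcases Nat.lt_succ_iff_lt_or_eq.1 hi with hi | rfl
      · obtain ⟨w, hw⟩ := ih i hi
        have hIco : ⋃ l ∈ Set.Ico (i + 1) (N + 1), ents (e l) =
            (⋃ l ∈ Set.Ico (i + 1) N, ents (e l)) ∪ ents (e N) := by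
          rw [← Set.insert_Ico_right_eq_Ico_add_one (Nat.succ_le_of_lt hi), Set.biUnion_insert,
            Set.union_comm]
        rw [hIco]
        refine hw.exists_union hC hA (small_of_countable hC.aleph0_lt
          ((Set.finite_Ico _ _).countable.biUnion fun l _ => (finite_ents _).countable)) hR
          ((he N).2.mono (Set.union_subset ?_ ?_))
        · exact Set.subset_biUnion_of_mem (u := fun l => ents (e l)) (s := Set.Iio N) hi
        · exact Set.biUnion_subset_biUnion_left fun l hl => hl.2
      · rw [Set.Ico_self, Set.biUnion_empty]
        obtain ⟨w, hw⟩ := ((he i).1.mono Set.subset_union_left).exists_pair hC hA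
          fun j => (y j, c j)
        exact ⟨w, hw0.of_sameType hR (by simpa using hw)⟩
  have hrank : ∀ N, rankGE P N Set.univ := fun N =>
    rankGE_of_forksAlong hC hA hR hbe (hw N) le_rfl .univ trivial
  have : Nonempty (Fin n) := ⟨(Set.mem_iUnion.1 (hcov hbD)).choose⟩
  choose j hj using fun m => rankGE.exists_single (fun _ : Fin n => m) (hrank (∑ _ : Fin n, m))
  obtain ⟨i, hi⟩ := Finite.exists_infinite_fiber j
  refine ⟨P i, fun m => ?_⟩
  obtain ⟨m', hm', hlt⟩ := (Set.infinite_coe_iff.1 hi).exists_gt m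
  obtain rfl : j m' = i := hm'
  exact (hj m').anti hlt.le

end Symmetry

theorem isRosy_iff_thornSymmetric {L : FirstOrder.Language.{u, v}} {C : Type w} [L.Structure C]
    {T : L.Theory} {κ : Cardinal.{w}} (hC : IsMonsterModel T C κ) :
    IsRosy L C ↔ ThornSymmetric L C κ := by
  constructor
  · intro hrosy A hA U X a b hab
    rw [thornIndep_iff] at hab ⊢
    by_contra hba
    obtain ⟨p, hp⟩ := exists_forall_rankGE_of_not_indep hC hA hab hba
    obtain ⟨α, hα⟩ := hrosy X p.Y p.Z Set.univ (definableOver_iff.2 .univ) {p.δ} {p.π}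
      (Set.finite_singleton _) (Set.finite_singleton _) p.k
    refine hα (thornRankGE_of_forall_rankGE hC (B := ∅) (Set.finite_singleton _)
      (Set.finite_singleton _) .univ (fun n => (hp n).of_forall_exists fun _ => ?_) α)
    exact ⟨(⟨p.δ, rfl⟩, ⟨p.π, rfl⟩), rfl⟩
  · intro hsym
    by_contra hrosy
    simp only [IsRosy, not_forall, not_exists, not_not] at hrosy
    obtain ⟨X, Y, Z, D, hD, Δ, Ps, hΔ, hPs, k, h⟩ := hrosy
    obtain ⟨V, b, Q, -, hQ, rfl⟩ := definableOver_iff.1 hD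
    have := hΔ.to_subtype
    have := hPs.to_subtype
    exact not_thornSymmetric_of_forall_rankGE hC (P := patterns Δ Ps k)
      (small_ents hC.aleph0_lt b) (.intro hQ b le_rfl)
      (fun n => rankGE_of_thornRankGE (h n)) hsym

end ThornForking

theorem mainTheorem2 {L : FirstOrder.Language.{u, v}} (T : L.Theory) (hT : T.IsComplete)
    (C : Type w) [L.Structure C] [Nonempty C] (κ : Cardinal.{w})
    (hC : ThornForking.IsMonsterModel T C κ) :
    ThornForking.IsRosy L C ↔ ThornForking.ThornSymmetric L C κ :=
  ThornForking.isRosy_iff_thornSymmetric hC
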